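/- Let $A$ be a real $K\times J$ matrix, $\beta,b\in\mathbb{R}^K$, $\gamma,c\in\mathbb{R}^J$, and $T\ge 0$. Consider the problem $$\text{M-CLP:}\qquad \max \int_{0-}^{T} (\gamma+(T-t)c)^{\mathsf T}\,dU(t)\quad\text{s.t.}\quad A\,U(t)\le \beta+bt,\quad 0\le t\le T,$$ over all functions $U:[0,T]\to\mathbb{R}^J$ that are componentwise non-negative, non-decreasing and right-continuous, and its symmetric dual $$\text{M-CLP}^*:\qquad \min \int_{0-}^{T} (\beta+(T-t)b)^{\mathsf T}\,dP(t)\quad\text{s.t.}\quad A^{\mathsf T}P(t)\ge \gamma+ct,\quad 0\le t\le T,$$ over all functions $P:[0,T]\to\mathbb{R}^K$ that are componentwise non-negative, non-decreasing and right-continuous. Inequalities between vectors are componentwise, the integrals are Lebesgue–Stieltjes integrals, and $U(0-)=0$, $P(0-)=0$ by convention, so that $U(0)$ and $P(0)$ count as jumps at time $0$. If M-CLP and M-CLP$^*$ are both feasible, then both have optimal solutions, and there is no duality gap: the maximum in M-CLP equals the minimum in M-CLP$^*$. -/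

import Mathlib

open MeasureTheory Set

noncomputable section

namespace MCLP

/-- A vector of cumulative controls over the time horizon `[0, T]`: a nonnegative, nondecreasing,
right-continuous function `[0, T] → ℝ^ι`. -/
structure Control (ι : Type*) (T : ℝ) where
  toFun : Icc (0 : ℝ) T → ι → ℝ
  nonneg' : ∀ t, 0 ≤ toFun t
  mono' : Monotone toFun
  right_continuous' : ∀ t, ContinuousWithinAt toFun (Ici t) t

instance {ι : Type*} {T : ℝ} : CoeFun (Control ι T) (fun _ => Icc (0 : ℝ) T → ι → ℝ) :=
  ⟨Control.toFun⟩

/-- The extension of the `i`-th coordinate of a control to the whole line, by the convention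
`U(0-) = 0` to the left of `0` and by the constant `U(T)` to the right of `T`. -/
def Control.extend {ι : Type*} {T : ℝ} (hT : 0 ≤ T) (U : Control ι T) (i : ι) :
    StieltjesFunction ℝ where
  toFun t := if t < 0 then 0 else U (projIcc 0 T hT t) i
  mono' := by
    intro s t hst
    dsimp only
    split_ifs with h1 h2 h2
    · exact le_rfl
    · exact U.nonneg' _ i
    · exact absurd (hst.trans_lt h2) h1
    · exact U.mono' (monotone_projIcc hT hst) i
  right_continuous' := by
    intro t
    by_cases ht : t < 0
    · refine ContinuousAt.continuousWithinAt ?_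
      refine (continuousAt_const (y := (0 : ℝ))).congr ?_
      filter_upwards [Iio_mem_nhds ht] with s hs
      exact (if_pos hs).symm
    · have h1 : ContinuousWithinAt (fun s => U (projIcc 0 T hT s)) (Ici t) t :=
        (U.right_continuous' (projIcc 0 T hT t)).comp
          (continuous_projIcc (h := hT)).continuousWithinAt
          (fun s hs => monotone_projIcc hT hs)
      refine (continuousWithinAt_pi.1 h1 i).congr ?_ ?_
      · intro s hs
        exact if_neg (fun h => ht (lt_of_le_of_lt hs h))
      · exact if_neg ht

/-- The Lebesgue–Stieltjes integral `∫_{0-}^T (g + (T - t) d)ᵀ dU(t)`; a jump of `U` from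
`U(0-) = 0` to `U(0)` at time `0` contributes an atom at `0`. -/
def objective {ι : Type*} [Fintype ι] {T : ℝ} (hT : 0 ≤ T) (g d : ι → ℝ) (U : Control ι T) : ℝ :=
  ∑ i, ∫ t in Icc 0 T, (g i + (T - t) * d i) ∂(U.extend hT i).measure

variable {K J : Type*} [Fintype K] [Fintype J] {T : ℝ}

/-- `U` is feasible for M-CLP: `A U(t) ≤ β + b t` for all `0 ≤ t ≤ T`. -/
def PrimalFeasible (A : Matrix K J ℝ) (β b : K → ℝ) (U : Control J T) : Prop :=
  ∀ t : Icc (0 : ℝ) T, A.mulVec (U t) ≤ β + (t : ℝ) • b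

/-- `P` is feasible for M-CLP*: `Aᵀ P(t) ≥ γ + c t` for all `0 ≤ t ≤ T`. -/
def DualFeasible (A : Matrix K J ℝ) (γ c : J → ℝ) (P : Control K T) : Prop :=
  ∀ t : Icc (0 : ℝ) T, γ + (t : ℝ) • c ≤ A.transpose.mulVec (P t)

/-- `U` is an optimal solution of M-CLP: it is feasible and maximizes
`∫_{0-}^T (γ + (T - t) c)ᵀ dU(t)` over all feasible controls. -/
def PrimalOptimal (hT : 0 ≤ T) (A : Matrix K J ℝ) (β b : K → ℝ) (γ c : J → ℝ)
    (U : Control J T) : Prop :=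
  PrimalFeasible A β b U ∧
    ∀ V : Control J T, PrimalFeasible A β b V → objective hT γ c V ≤ objective hT γ c U

/-- `P` is an optimal solution of M-CLP*: it is feasible and minimizes
`∫_{0-}^T (β + (T - t) b)ᵀ dP(t)` over all feasible controls. -/
def DualOptimal (hT : 0 ≤ T) (A : Matrix K J ℝ) (β b : K → ℝ) (γ c : J → ℝ)
    (P : Control K T) : Prop :=
  DualFeasible A γ c P ∧
    ∀ Q : Control K T, DualFeasible A γ c Q → objective hT β b P ≤ objective hT β b Q

end MCLP

end

/-! Weak duality is Fubini: the pairing of dU and dP through A over {s + t ≤ T} can be evaluated in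
either order (`objective_le_objective`). For the converse, both problems are restricted to a grid of
mesh h = T/N, with dual time reversed. The restrictions are dual linear programs, so finite strong
duality gives increments u, p with equal values and complementary slackness (`exists_gridPair`). The
difficulty is the limit N → ∞: u has no evident bound independent of N, while linear interpolation
changes the objective by h/2 times cᵀ of the increments.

The crux is a finiteness phenomenon. Complementary slackness at neighbouring grid points gives h
cᵀu_{n+1} ≤ h bᵀp_{N-n} ≤ h cᵀu_n, so the rates h cᵀu_n are nonincreasing for n ≥ 1; they are even
constant between two occurrences of the same pattern (support of u_n, support of the slack at n -
1). There are finitely many patterns, so the grid splits into a number M of constant-rate pieces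
that does not depend on N (`GridPair.exists_breakpoints`). On such a piece the objective sees only
the total increment, so u collapses to M + 1 increments. The collapsed program has a constraint
matrix independent of N and of the breakpoints, hence its increments can be replaced by uniformly
bounded ones at no loss (`step_exists_bounded`), and interpolation then costs only O(1/N)
(`exists_stepValue_ge`).

Breakpoints and bounded increments range over a compact set, so a single best piecewise linear U
reaches every grid value up to C/N. The symmetry that negates the data and exchanges the problems
gives P likewise. As N → ∞ the objective of P is at most that of U, and weak duality makes both
optimal. -/

namespace MCLP

/-! ### Finite linear programming: bounded solutions, Farkas, strong duality -/

section LinearProgramming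

variable {ι κ : Type*} [Fintype ι]

/-- A nonnegative vector can be replaced by one with an independent support and the same image,
without decreasing a linear functional that is nonpositive on the recession cone. -/
theorem exists_independent_support (W : (ι → ℝ) →ₗ[ℝ] (κ → ℝ)) (g : ι → ℝ)
    (hg : ∀ d : ι → ℝ, 0 ≤ d → W d = 0 → g ⬝ᵥ d ≤ 0) (x : ι → ℝ) (hx : 0 ≤ x) :
    ∃ y : ι → ℝ, 0 ≤ y ∧ W y = W x ∧ g ⬝ᵥ x ≤ g ⬝ᵥ y ∧
      ∀ d : ι → ℝ, (∀ i, y i = 0 → d i = 0) → W d = 0 → d = 0 := by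
  classical
  induction hn : (Finset.univ.filter fun i => x i ≠ 0).card using Nat.strong_induction_on
    generalizing x with
  | _ n ih =>
    by_cases h : ∀ d : ι → ℝ, (∀ i, x i = 0 → d i = 0) → W d = 0 → d = 0
    · exact ⟨x, hx, rfl, le_rfl, h⟩
    push Not at h
    obtain ⟨d, hds, hWd, hd⟩ := h
    -- A kernel direction that does not decrease g and has a negative coordinate. If d or -d is
    -- nonnegative, `hg` forces the choice of the opposite sign; otherwise both have negative
    -- coordinates and the sign of g ⬝ᵥ d decides.
    have hdir : ∃ d : ι → ℝ, (∀ i, x i = 0 → d i = 0) ∧ W d = 0 ∧ 0 ≤ g ⬝ᵥ d ∧ ∃ i, d i < 0 := by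
      have hs' : ∀ i, x i = 0 → (-d) i = 0 := fun i hi => by simp [hds i hi]
      have hW' : W (-d) = 0 := by simp [hWd]
      by_cases hp : 0 ≤ d
      · have h1 := hg d hp hWd
        refine ⟨-d, hs', hW', by simpa using h1, ?_⟩
        obtain ⟨i, hi⟩ := Function.ne_iff.1 hd
        exact ⟨i, by simpa using lt_of_le_of_ne (hp i) (Ne.symm hi)⟩
      by_cases hm : 0 ≤ -d
      · have h1 := hg (-d) hm hW'
        refine ⟨d, hds, hWd, by simpa using h1, ?_⟩
        obtain ⟨i, hi⟩ := Function.ne_iff.1 hd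
        refine ⟨i, lt_of_le_of_ne ?_ hi⟩
        simpa using hm i
      rcases le_total 0 (g ⬝ᵥ d) with h0 | h0
      · refine ⟨d, hds, hWd, h0, ?_⟩
        by_contra! hc
        exact hp hc
      · refine ⟨-d, hs', hW', by simpa using h0, ?_⟩
        by_contra! hc
        exact hm hc
    obtain ⟨e, hes, hWe, hge, i₀, hi₀⟩ := hdir
    obtain ⟨k, hk, hkmin⟩ := Finset.exists_min_image (Finset.univ.filter fun i => e i < 0)
      (fun i => x i / -e i) ⟨i₀, by simpa using hi₀⟩
    have hek : e k < 0 := by simpa using hk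
    -- Ratio test: the largest step along e that preserves nonnegativity. Coordinate k becomes zero
    -- and no new one is created, so the support shrinks strictly.
    set r : ℝ := x k / -e k with hr
    have hr0 : 0 ≤ r := div_nonneg (hx k) (by linarith)
    have hy : 0 ≤ x + r • e := by
      intro i
      change 0 ≤ x i + r * e i
      rcases le_or_gt 0 (e i) with h1 | h1
      · exact add_nonneg (hx i) (mul_nonneg hr0 h1)
      · have h2 := hkmin i (by simpa using h1)
        rw [le_div_iff₀ (by linarith)] at h2
        linarith
    have hyk : (x + r • e) k = 0 := by
      change x k + x k / -e k * e k = 0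
      rw [div_neg, neg_mul, div_mul_cancel₀ _ hek.ne, add_neg_cancel]
    have hxk : x k ≠ 0 := fun h0 => hek.ne (hes k h0)
    have hlt : (Finset.univ.filter fun i => (x + r • e) i ≠ 0).card < n := by
      rw [← hn]
      refine Finset.card_lt_card ⟨fun i hi => ?_, fun hsub => ?_⟩
      · simp only [Finset.mem_filter, Finset.mem_univ, true_and] at hi ⊢
        intro h0
        exact hi (by simp [h0, hes i h0])
      · have := hsub (show k ∈ _ by simpa using hxk)
        simp only [Finset.mem_filter, Finset.mem_univ, true_and] at this
        exact this hyk
    obtain ⟨y, hy0, hWy, hgy, hind⟩ := ih _ hlt (x + r • e) hy rfl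
    refine ⟨y, hy0, by simp [hWy, hWe], ?_, hind⟩
    refine le_trans ?_ hgy
    rw [dotProduct_add, dotProduct_smul, smul_eq_mul]
    nlinarith [mul_nonneg hr0 hge]

variable [Fintype κ]

/-- A linear map is bounded below, uniformly, on vectors whose support selects an independent
set of columns. -/
theorem exists_norm_le_of_independent_support (W : (ι → ℝ) →ₗ[ℝ] (κ → ℝ)) :
    ∃ C : ℝ, 0 ≤ C ∧ ∀ x : ι → ℝ,
      (∀ d : ι → ℝ, (∀ i, x i = 0 → d i = 0) → W d = 0 → d = 0) → ‖x‖ ≤ C * ‖W x‖ := by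
  classical
  let E : Set ι → Submodule ℝ (ι → ℝ) := fun S =>
    { carrier := {d | ∀ i, i ∈ S → d i = 0}
      add_mem' := fun {a b} ha hb i hi => by simp [ha i hi, hb i hi]
      zero_mem' := fun i _ => rfl
      smul_mem' := fun r a ha i hi => by simp [ha i hi] }
  have key : ∀ S : Set ι, ∃ C : ℝ, 0 ≤ C ∧
      ((∀ d ∈ E S, W d = 0 → d = 0) → ∀ x ∈ E S, ‖x‖ ≤ C * ‖W x‖) := by
    intro S
    by_cases h : ∀ d ∈ E S, W d = 0 → d = 0
    · have hker : LinearMap.ker (W.domRestrict (E S)) = ⊥ := by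
        rw [LinearMap.ker_eq_bot']
        rintro ⟨d, hd⟩ h0
        exact Subtype.ext (h d hd h0)
      obtain ⟨C, -, hC⟩ := LinearMap.exists_antilipschitzWith _ hker
      refine ⟨C, C.2, fun _ x hx => ?_⟩
      simpa using hC.le_mul_dist ⟨x, hx⟩ 0
    · exact ⟨0, le_rfl, fun h' => absurd h' h⟩
  choose C hC0 hC using key
  -- There are finitely many zero sets S, so the sum of their constants serves for all of them.
  refine ⟨∑ S, C S, Finset.sum_nonneg fun S _ => hC0 S, fun x hx => ?_⟩
  refine (hC {i | x i = 0} hx x (fun i hi => hi)).trans ?_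
  exact mul_le_mul_of_nonneg_right
    (Finset.single_le_sum (f := C) (fun S _ => hC0 S) (Finset.mem_univ _)) (norm_nonneg _)

/-- Nonnegative vectors can be replaced by ones that are controlled by their image, without
decreasing a linear functional that is nonpositive on the recession cone. -/
theorem exists_bounded_preimage (W : (ι → ℝ) →ₗ[ℝ] (κ → ℝ)) :
    ∃ C : ℝ, 0 ≤ C ∧ ∀ g : ι → ℝ, (∀ d : ι → ℝ, 0 ≤ d → W d = 0 → g ⬝ᵥ d ≤ 0) →
      ∀ x : ι → ℝ, 0 ≤ x →
        ∃ y : ι → ℝ, 0 ≤ y ∧ W y = W x ∧ g ⬝ᵥ x ≤ g ⬝ᵥ y ∧ ‖y‖ ≤ C * ‖W x‖ := by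
  obtain ⟨C, hC0, hC⟩ := exists_norm_le_of_independent_support W
  refine ⟨C, hC0, fun g hg x hx => ?_⟩
  obtain ⟨y, hy, hW, hgy, hind⟩ := exists_independent_support W g hg x hx
  exact ⟨y, hy, hW, hgy, hW ▸ hC y hind⟩

/-- A finitely generated cone is closed. -/
theorem isClosed_image_nonneg (W : (ι → ℝ) →ₗ[ℝ] (κ → ℝ)) : IsClosed (W '' Ici 0) := by
  obtain ⟨C, hC0, hC⟩ := exists_bounded_preimage W
  refine isClosed_of_closure_subset fun z hz => ?_
  let R : ℝ := C * (‖z‖ + 1)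
  have hcomp : IsCompact (W '' (Ici 0 ∩ Metric.closedBall 0 R)) :=
    ((isCompact_closedBall 0 R).inter_left isClosed_Ici).image W.continuous_of_finiteDimensional
  -- Near z the cone is covered by the image of a compact set, because preimages can be chosen
  -- bounded.
  have hsub : W '' Ici 0 ∩ Metric.ball z 1 ⊆ W '' (Ici 0 ∩ Metric.closedBall 0 R) := by
    rintro _ ⟨⟨x, hx, rfl⟩, hb⟩
    obtain ⟨y, hy, hW, -, hn⟩ := hC 0 (by simp) x hx
    refine ⟨y, ⟨hy, ?_⟩, hW⟩
    rw [mem_closedBall_zero_iff]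
    refine hn.trans (mul_le_mul_of_nonneg_left ?_ hC0)
    have h1 : ‖W x - z‖ < 1 := by simpa [dist_eq_norm] using hb
    linarith [norm_le_norm_add_norm_sub' (W x) z]
  have hz' : z ∈ closure (W '' Ici 0 ∩ Metric.ball z 1) :=
    mem_closure_iff_nhdsWithin_neBot.2 (by
      rw [nhdsWithin_inter_of_mem' ]
      · exact mem_closure_iff_nhdsWithin_neBot.1 hz
      · exact mem_nhdsWithin_of_mem_nhds (Metric.ball_mem_nhds z one_pos))
  have h2 := closure_minimal hsub hcomp.isClosed hz'
  exact (image_mono inter_subset_left) h2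

/-- **Farkas' lemma** for equality constraints. -/
theorem farkas_eq (W : (ι → ℝ) →ₗ[ℝ] (κ → ℝ)) (e : κ → ℝ) (h : ¬∃ x, 0 ≤ x ∧ W x = e) :
    ∃ w : κ → ℝ, (∀ x, 0 ≤ x → 0 ≤ w ⬝ᵥ W x) ∧ w ⬝ᵥ e < 0 := by
  classical
  have hconv : Convex ℝ (W '' Ici 0) := (convex_Ici 0).linear_image W
  obtain ⟨f, s, hs, hf⟩ := geometric_hahn_banach_point_closed (x := e) hconv
    (isClosed_image_nonneg W) (by rintro ⟨x, hx, hxe⟩; exact h ⟨x, hx, hxe⟩)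
  have hfw : ∀ z : κ → ℝ, f z = (fun k => f (Pi.single k 1)) ⬝ᵥ z := by
    intro z
    conv_lhs => rw [pi_eq_sum_univ' z]
    simp only [map_sum, map_smul, dotProduct, smul_eq_mul]
    refine Finset.sum_congr rfl fun i _ => ?_
    rw [mul_comm]
  have hs0 : s < 0 := by simpa using hf 0 ⟨0, by simp, by simp⟩
  refine ⟨fun k => f (Pi.single k 1), fun x hx => ?_, ?_⟩
  · rw [← hfw]
    by_contra! hneg
    have h1 := hf (W ((s / f (W x)) • x))
      ⟨_, smul_nonneg (div_nonneg_of_nonpos hs0.le hneg.le) hx, rfl⟩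
    rw [map_smul, map_smul, smul_eq_mul, div_mul_cancel₀ _ hneg.ne] at h1
    exact lt_irrefl _ h1
  · rw [← hfw]
    linarith


/-- **Farkas' lemma** for inequality constraints. -/
theorem farkas_le (A : Matrix κ ι ℝ) (e : κ → ℝ) (h : ¬∃ x, 0 ≤ x ∧ A.mulVec x ≤ e) :
    ∃ w : κ → ℝ, 0 ≤ w ∧ 0 ≤ Matrix.vecMul w A ∧ w ⬝ᵥ e < 0 := by
  classical
  obtain ⟨w, hw, hwe⟩ := farkas_eq (Matrix.fromCols A (1 : Matrix κ κ ℝ)).mulVecLin e (by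
    rintro ⟨z, hz, hze⟩
    refine h ⟨z ∘ Sum.inl, fun i => hz _, ?_⟩
    rw [Matrix.mulVecLin_apply, Matrix.fromCols_mulVec, Matrix.one_mulVec] at hze
    rw [← hze]
    exact le_add_of_nonneg_right fun k => hz _)
  refine ⟨w, fun k => ?_, fun i => ?_, hwe⟩
  · have h1 : (0 : κ → ℝ) ≤ Pi.single k 1 := Pi.single_nonneg.2 zero_le_one
    have := hw (Sum.elim (0 : ι → ℝ) (Pi.single k 1 : κ → ℝ)) (by
      rintro (i | i)
      · exact le_rfl
      · exact h1 i)
    rw [Matrix.mulVecLin_apply, Matrix.fromCols_mulVec, Matrix.one_mulVec,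
      Sum.elim_comp_inl, Sum.elim_comp_inr] at this
    simpa using this
  · have h1 : (0 : ι → ℝ) ≤ Pi.single i 1 := Pi.single_nonneg.2 zero_le_one
    have := hw (Sum.elim (Pi.single i 1 : ι → ℝ) (0 : κ → ℝ)) (by
      rintro (j | j)
      · exact h1 j
      · exact le_rfl)
    rw [Matrix.mulVecLin_apply, Matrix.fromCols_mulVec, Matrix.one_mulVec] at this
    simp only [Sum.elim_comp_inl, Sum.elim_comp_inr, add_zero, Matrix.dotProduct_mulVec,
      dotProduct_single, mul_one] at this
    exact this

/-- Weak duality for linear programs. -/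
theorem lp_weak_duality (A : Matrix κ ι ℝ) {r : κ → ℝ} {g x : ι → ℝ} {y : κ → ℝ}
    (hx : 0 ≤ x) (hxr : A.mulVec x ≤ r) (hy : 0 ≤ y) (hyg : g ≤ Matrix.vecMul y A) :
    g ⬝ᵥ x ≤ y ⬝ᵥ r :=
  calc g ⬝ᵥ x ≤ Matrix.vecMul y A ⬝ᵥ x := dotProduct_le_dotProduct_of_nonneg_right hyg hx
    _ = y ⬝ᵥ A.mulVec x := (Matrix.dotProduct_mulVec _ _ _).symm
    _ ≤ y ⬝ᵥ r := dotProduct_le_dotProduct_of_nonneg_left hxr hy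

/-- Strong duality for feasible linear programs with feasible duals. -/
theorem lp_strong_duality (A : Matrix κ ι ℝ) (r : κ → ℝ) (g : ι → ℝ)
    (hp : ∃ x, 0 ≤ x ∧ A.mulVec x ≤ r) (hd : ∃ y, 0 ≤ y ∧ g ≤ Matrix.vecMul y A) :
    ∃ (x : ι → ℝ) (y : κ → ℝ), (0 ≤ x ∧ A.mulVec x ≤ r) ∧ (0 ≤ y ∧ g ≤ Matrix.vecMul y A) ∧
      g ⬝ᵥ x = y ⬝ᵥ r := by
  obtain ⟨x₀, hx₀, hxr₀⟩ := hp
  obtain ⟨y₀, hy₀, hyg₀⟩ := hd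
  -- The rows encode primal feasibility, dual feasibility and g ⬝ᵥ x ≥ y ⬝ᵥ r, so by weak duality a
  -- solution of the system is an optimal pair.
  let B : Matrix ((κ ⊕ ι) ⊕ Unit) (ι ⊕ κ) ℝ :=
    Matrix.fromRows (Matrix.fromRows (Matrix.fromCols A 0) (Matrix.fromCols 0 (-A.transpose)))
      (Matrix.fromCols (Matrix.replicateRow Unit (-g)) (Matrix.replicateRow Unit r))
  have hB : ∃ z, 0 ≤ z ∧ B.mulVec z ≤ Sum.elim (Sum.elim r (-g)) 0 := by
    by_contra hB
    obtain ⟨w, hw, hwB, hwe⟩ := farkas_le B _ hB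
    obtain ⟨l, m, n, rfl⟩ : ∃ (l : κ → ℝ) (m : ι → ℝ) (n : Unit → ℝ),
        w = Sum.elim (Sum.elim l m) n :=
      ⟨fun k => w (Sum.inl (Sum.inl k)), fun i => w (Sum.inl (Sum.inr i)),
        fun k => w (Sum.inr k), by ext ((k | k) | k) <;> rfl⟩
    have hl : 0 ≤ l := fun k => hw (Sum.inl (Sum.inl k))
    have hm : 0 ≤ m := fun k => hw (Sum.inl (Sum.inr k))
    have hn : 0 ≤ n () := hw (Sum.inr ())
    simp only [sumElim_dotProduct_sumElim, dotProduct_neg, dotProduct_zero,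
      add_zero] at hwe
    simp only [B, Matrix.sumElim_vecMul_fromRows, Matrix.vecMul_fromCols] at hwB
    have h1 : n () • g ≤ Matrix.vecMul l A := fun i => by
      have := hwB (Sum.inl i)
      simp [Matrix.vecMul, dotProduct, Matrix.replicateRow] at this ⊢
      linarith
    have h2 : A.mulVec m ≤ n () • r := fun k => by
      have := hwB (Sum.inr k)
      simp [Matrix.vecMul, Matrix.mulVec, dotProduct, Matrix.replicateRow, mul_comm] at this ⊢
      linarith
    -- If the multiplier of the value row is zero, l and m are recession directions, and the
    -- feasible points exclude the certificate. Otherwise m and l, divided by the multiplier, would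
    -- violate weak duality.
    rcases hn.eq_or_lt with h0 | h0
    · rw [← h0, zero_smul] at h1 h2
      have h3 := lp_weak_duality A hx₀ hxr₀ hl h1
      have h4 := lp_weak_duality A hm h2 hy₀ hyg₀
      rw [dotProduct_comm] at h4
      simp only [zero_dotProduct, dotProduct_zero] at h3 h4
      linarith
    · have h3 := lp_weak_duality A hm h2 hl h1
      rw [smul_dotProduct, dotProduct_smul, smul_eq_mul, smul_eq_mul] at h3
      have h4 := le_of_mul_le_mul_left h3 h0
      rw [dotProduct_comm g] at h4
      linarith
  obtain ⟨z, hz, hBz⟩ := hB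
  obtain ⟨x, y, rfl⟩ : ∃ (x : ι → ℝ) (y : κ → ℝ), z = Sum.elim x y :=
    ⟨z ∘ Sum.inl, z ∘ Sum.inr, by ext (k | k) <;> rfl⟩
  have hx : 0 ≤ x := fun i => hz (Sum.inl i)
  have hy : 0 ≤ y := fun i => hz (Sum.inr i)
  simp only [B, Matrix.fromRows_mulVec, Matrix.fromCols_mulVec_sumElim] at hBz
  have hxr : A.mulVec x ≤ r := fun k => by
    have := hBz (Sum.inl (Sum.inl k))
    simpa using this
  have hyg : g ≤ Matrix.vecMul y A := fun i => by
    have := hBz (Sum.inl (Sum.inr i))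
    simp [Matrix.neg_mulVec, Matrix.mulVec_transpose] at this
    exact this
  refine ⟨x, y, ⟨hx, hxr⟩, ⟨hy, hyg⟩, le_antisymm (lp_weak_duality A hx hxr hy hyg) ?_⟩
  have := hBz (Sum.inr ())
  simp [Matrix.mulVec, Matrix.replicateRow] at this
  change -g ⬝ᵥ x + r ⬝ᵥ y ≤ 0 at this
  rw [neg_dotProduct, dotProduct_comm r] at this
  linarith

/-- Feasible points of a linear program can be replaced by ones that are controlled by the right
hand side, without decreasing an objective that is nonpositive on the recession cone. The
bound depends on the constraint matrix only. -/
theorem exists_bounded_feasible (A : Matrix κ ι ℝ) :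
    ∃ C : ℝ, 0 ≤ C ∧ ∀ (r : κ → ℝ) (g : ι → ℝ),
      (∀ d : ι → ℝ, 0 ≤ d → A.mulVec d ≤ 0 → g ⬝ᵥ d ≤ 0) →
      ∀ x : ι → ℝ, 0 ≤ x → A.mulVec x ≤ r →
        ∃ y : ι → ℝ, 0 ≤ y ∧ A.mulVec y ≤ r ∧ g ⬝ᵥ x ≤ g ⬝ᵥ y ∧ ∀ i, y i ≤ C * ‖r‖ := by
  classical
  -- Slack variables turn the inequalities into equations without affecting the dependence of C on A
  -- alone.
  obtain ⟨C, hC0, hC⟩ := exists_bounded_preimage (Matrix.fromCols A (1 : Matrix κ κ ℝ)).mulVecLin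
  refine ⟨C, hC0, fun r g hg x hx hxr => ?_⟩
  obtain ⟨z, hz, hzr, hgz, hzn⟩ := hC (Sum.elim g 0) (by
    intro d hd h0
    rw [Matrix.mulVecLin_apply, Matrix.fromCols_mulVec, Matrix.one_mulVec] at h0
    have h1 := hg (d ∘ Sum.inl) (fun i => hd _) (by
      rw [eq_neg_of_add_eq_zero_left h0]
      exact neg_nonpos.2 fun k => hd _)
    rw [← Sum.elim_comp_inl_inr d, sumElim_dotProduct_sumElim]
    simpa using h1) (Sum.elim x (r - A.mulVec x)) (by
      rintro (i | k)
      · exact hx i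
      · exact sub_nonneg.2 (hxr k))
  simp only [Matrix.mulVecLin_apply, Matrix.fromCols_mulVec, Matrix.one_mulVec,
    Sum.elim_comp_inl, Sum.elim_comp_inr, add_sub_cancel] at hzr hzn
  refine ⟨z ∘ Sum.inl, fun i => hz _, ?_, ?_, fun i => ?_⟩
  · rw [← hzr]
    exact le_add_of_nonneg_right fun k => hz _
  · rw [← Sum.elim_comp_inl_inr z, sumElim_dotProduct_sumElim,
      sumElim_dotProduct_sumElim] at hgz
    simpa using hgz
  · exact (le_abs_self _).trans ((norm_le_pi_norm z (Sum.inl i)).trans hzn)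

end LinearProgramming

/-! ### Linear programs in the increments of a control -/

section StepPrograms

/-- Complementary slackness at a pair of optimal solutions of a linear program and its dual. -/
theorem lp_complementary_slackness {ι κ : Type*} [Fintype ι] [Fintype κ] (A : Matrix κ ι ℝ)
    {r : κ → ℝ} {g x : ι → ℝ} {y : κ → ℝ}
    (hx : 0 ≤ x) (hxr : A.mulVec x ≤ r) (hy : 0 ≤ y) (hyg : g ≤ Matrix.vecMul y A)
    (h : g ⬝ᵥ x = y ⬝ᵥ r) :
    (∀ i, x i * (Matrix.vecMul y A i - g i) = 0) ∧ ∀ k, y k * (r k - A.mulVec x k) = 0 := by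
  have h1 : 0 ≤ ∑ i, x i * (Matrix.vecMul y A i - g i) :=
    Finset.sum_nonneg fun i _ => mul_nonneg (hx i) (sub_nonneg.2 (hyg i))
  have h2 : 0 ≤ ∑ k, y k * (r k - A.mulVec x k) :=
    Finset.sum_nonneg fun k _ => mul_nonneg (hy k) (sub_nonneg.2 (hxr k))
  have h3 : ∑ i, x i * (Matrix.vecMul y A i - g i) + ∑ k, y k * (r k - A.mulVec x k) = 0 := by
    have h4 : ∑ i, x i * (Matrix.vecMul y A i - g i) = Matrix.vecMul y A ⬝ᵥ x - g ⬝ᵥ x := by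
      rw [dotProduct, dotProduct, ← Finset.sum_sub_distrib]
      exact Finset.sum_congr rfl fun i _ => by ring
    have h5 : ∑ k, y k * (r k - A.mulVec x k) = y ⬝ᵥ r - y ⬝ᵥ A.mulVec x := by
      rw [dotProduct, dotProduct, ← Finset.sum_sub_distrib]
      exact Finset.sum_congr rfl fun i _ => by ring
    rw [h4, h5, Matrix.dotProduct_mulVec, h]
    ring
  constructor
  · intro i
    exact (Finset.sum_eq_zero_iff_of_nonneg
      fun i _ => mul_nonneg (hx i) (sub_nonneg.2 (hyg i))).1 (by linarith) i (Finset.mem_univ i)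
  · intro k
    exact (Finset.sum_eq_zero_iff_of_nonneg
      fun k _ => mul_nonneg (hy k) (sub_nonneg.2 (hxr k))).1 (by linarith) k (Finset.mem_univ k)

variable {K J : Type*} [Fintype J]

/-- The constraint matrix of a program in which the increments of a control at the times
`0, …, n` are the variables. -/
def stepMatrix (A : Matrix K J ℝ) (n : ℕ) : Matrix (Fin (n + 1) × K) (Fin (n + 1) × J) ℝ :=
  Matrix.of fun k l => if l.1 ≤ k.1 then A k.2 l.2 else 0

/-- The initial segment of a sequence of vectors, as a single vector. -/
def segment {ι : Type*} (n : ℕ) (u : ℕ → ι → ℝ) : Fin (n + 1) × ι → ℝ := fun q => u q.1 q.2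

theorem segment_dotProduct {ι : Type*} [Fintype ι] (n : ℕ) (g u : ℕ → ι → ℝ) :
    segment n g ⬝ᵥ segment n u = ∑ l ∈ Finset.range (n + 1), g l ⬝ᵥ u l := by
  rw [dotProduct, Fintype.sum_prod_type, Finset.sum_range]
  rfl

theorem exists_segment_eq {ι : Type*} (n : ℕ) (x : Fin (n + 1) × ι → ℝ) (hx : 0 ≤ x) :
    ∃ u : ℕ → ι → ℝ, (∀ l, 0 ≤ u l) ∧ segment n u = x := by
  refine ⟨fun l i => if h : l < n + 1 then x (⟨l, h⟩, i) else 0, fun l i => ?_, ?_⟩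
  · dsimp only
    split_ifs with h
    · exact hx _
    · exact le_rfl
  · ext ⟨l, i⟩
    simp [segment, Nat.lt_succ_iff.1 l.2]

theorem stepMatrix_mulVec (A : Matrix K J ℝ) (n : ℕ) (u : ℕ → J → ℝ) (k : Fin (n + 1)) (i : K) :
    (stepMatrix A n).mulVec (segment n u) (k, i) =
      A.mulVec (∑ l ∈ Finset.range (k + 1), u l) i := by
  have h1 : (stepMatrix A n).mulVec (segment n u) (k, i) =
      ∑ l : Fin (n + 1), if (l : ℕ) < k + 1 then A.mulVec (u l) i else 0 := by
    rw [Matrix.mulVec, dotProduct, Fintype.sum_prod_type]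
    refine Finset.sum_congr rfl fun l _ => ?_
    by_cases h : l ≤ k
    · have h' : (l : ℕ) < k + 1 := Nat.lt_succ_of_le h
      simp [stepMatrix, segment, h, h', Matrix.mulVec, dotProduct]
    · have h' : ¬(l : ℕ) < k + 1 := fun h'' => h (Nat.le_of_lt_succ h'')
      simp [stepMatrix, segment, h, h']
  rw [h1, ← Finset.sum_range fun l => if l < k + 1 then A.mulVec (u l) i else 0,
    Matrix.mulVec_sum, Finset.sum_apply, ← Finset.sum_filter]
  refine Finset.sum_congr ?_ fun _ _ => rfl
  ext l
  simp only [Finset.mem_filter, Finset.mem_range]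
  have := k.2
  omega

theorem stepMatrix_mulVec_le_iff (A : Matrix K J ℝ) (n : ℕ) (r : ℕ → K → ℝ) (u : ℕ → J → ℝ) :
    (stepMatrix A n).mulVec (segment n u) ≤ segment n r ↔
      ∀ k ≤ n, A.mulVec (∑ l ∈ Finset.range (k + 1), u l) ≤ r k := by
  constructor
  · intro h k hk i
    have := h (⟨k, Nat.lt_succ_of_le hk⟩, i)
    rwa [stepMatrix_mulVec] at this
  · rintro h ⟨k, i⟩
    rw [stepMatrix_mulVec]
    exact h k (Nat.le_of_lt_succ k.2) i

/-- Column l meets only the rows k ≥ l. Reversing dual time turns this tail into an initial segment,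
which gives the dual program the same cumulative form. -/
theorem vecMul_stepMatrix {K J : Type*} [Fintype K] (A : Matrix K J ℝ) (n : ℕ) (p : ℕ → K → ℝ)
    (l : Fin (n + 1)) (j : J) :
    Matrix.vecMul (segment n fun k => p (n - k)) (stepMatrix A n) (l, j) =
      Matrix.vecMul (∑ m ∈ Finset.range (n - l + 1), p m) A j := by
  have h1 : Matrix.vecMul (segment n fun k => p (n - k)) (stepMatrix A n) (l, j) =
      ∑ k : Fin (n + 1), if (l : ℕ) ≤ k then Matrix.vecMul (p (n - k)) A j else 0 := by
    rw [Matrix.vecMul, dotProduct, Fintype.sum_prod_type]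
    refine Finset.sum_congr rfl fun k _ => ?_
    by_cases h : l ≤ k
    · have h' : (l : ℕ) ≤ k := h
      simp [stepMatrix, segment, h, h', Matrix.vecMul, dotProduct]
    · have h' : ¬(l : ℕ) ≤ k := h
      simp [stepMatrix, segment, h, h']
  rw [h1, ← Finset.sum_range fun k => if (l : ℕ) ≤ k then Matrix.vecMul (p (n - k)) A j else 0,
    Matrix.sum_vecMul, Finset.sum_apply, ← Finset.sum_filter]
  have := l.2
  refine Finset.sum_nbij' (fun k => n - k) (fun k => n - k) ?_ ?_ ?_ ?_ ?_
  all_goals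
    simp only [Finset.mem_filter, Finset.mem_range]
    intros
  · omega
  · omega
  · omega
  · omega
  · trivial

variable [Fintype K]

/-- Strong duality and complementary slackness for step programs; the dual variables are indexed
in reversed time. -/
theorem step_strong_duality (A : Matrix K J ℝ) (n : ℕ) (r : ℕ → K → ℝ) (g : ℕ → J → ℝ)
    (hp : ∃ u : ℕ → J → ℝ, (∀ l, 0 ≤ u l) ∧
      ∀ k ≤ n, A.mulVec (∑ l ∈ Finset.range (k + 1), u l) ≤ r k)
    (hd : ∃ p : ℕ → K → ℝ, (∀ m, 0 ≤ p m) ∧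
      ∀ m ≤ n, g (n - m) ≤ Matrix.vecMul (∑ l ∈ Finset.range (m + 1), p l) A) :
    ∃ (u : ℕ → J → ℝ) (p : ℕ → K → ℝ), (∀ l, 0 ≤ u l) ∧ (∀ m, 0 ≤ p m) ∧
      (∀ k ≤ n, A.mulVec (∑ l ∈ Finset.range (k + 1), u l) ≤ r k) ∧
      (∀ m ≤ n, g (n - m) ≤ Matrix.vecMul (∑ l ∈ Finset.range (m + 1), p l) A) ∧
      (∀ l ≤ n, ∀ j, u l j *
        (Matrix.vecMul (∑ m ∈ Finset.range (n - l + 1), p m) A j - g l j) = 0) ∧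
      (∀ k ≤ n, ∀ i, p (n - k) i *
        (r k i - A.mulVec (∑ l ∈ Finset.range (k + 1), u l) i) = 0) ∧
      ∑ l ∈ Finset.range (n + 1), g l ⬝ᵥ u l =
        ∑ m ∈ Finset.range (n + 1), r (n - m) ⬝ᵥ p m := by
  have feas_iff := stepMatrix_mulVec_le_iff A n r
  have dfeas_iff : ∀ p : ℕ → K → ℝ,
      segment n g ≤ Matrix.vecMul (segment n fun k => p (n - k)) (stepMatrix A n) ↔
      ∀ m ≤ n, g (n - m) ≤ Matrix.vecMul (∑ l ∈ Finset.range (m + 1), p l) A := by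
    intro p
    constructor
    · intro h m hm j
      have := h (⟨n - m, by omega⟩, j)
      rw [vecMul_stepMatrix] at this
      simpa [segment, Nat.sub_sub_self hm] using this
    · rintro h ⟨l, j⟩
      rw [vecMul_stepMatrix]
      have := h (n - l) (by omega) j
      rwa [Nat.sub_sub_self (Nat.le_of_lt_succ l.2)] at this
  obtain ⟨u₀, hu₀, hur₀⟩ := hp
  obtain ⟨p₀, hp₀, hpg₀⟩ := hd
  obtain ⟨x, y, ⟨hx, hxr⟩, ⟨hy, hyg⟩, hval⟩ := lp_strong_duality (stepMatrix A n) (segment n r)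
    (segment n g) ⟨segment n u₀, fun q => hu₀ _ _, (feas_iff u₀).2 hur₀⟩
    ⟨segment n fun k => p₀ (n - k), fun q => hp₀ _ _, (dfeas_iff p₀).2 hpg₀⟩
  obtain ⟨u, hu, rfl⟩ := exists_segment_eq n x hx
  obtain ⟨p', hp', hyp⟩ := exists_segment_eq n y hy
  obtain ⟨p, hp, rfl⟩ : ∃ p : ℕ → K → ℝ, (∀ m, 0 ≤ p m) ∧ y = segment n fun k => p (n - k) := by
    refine ⟨fun m => p' (n - m), fun m => hp' _, ?_⟩
    rw [← hyp]
    ext ⟨k, i⟩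
    simp [segment, Nat.sub_sub_self (Nat.le_of_lt_succ k.2)]
  obtain ⟨hc1, hc2⟩ := lp_complementary_slackness _ hx hxr hy hyg hval
  refine ⟨u, p, hu, hp, (feas_iff u).1 hxr, (dfeas_iff p).1 hyg, fun l hl j => ?_,
    fun k hk i => ?_, ?_⟩
  · have := hc1 (⟨l, Nat.lt_succ_of_le hl⟩, j)
    rwa [vecMul_stepMatrix] at this
  · have := hc2 (⟨k, Nat.lt_succ_of_le hk⟩, i)
    rwa [stepMatrix_mulVec] at this
  · rw [segment_dotProduct, segment_dotProduct] at hval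
    rw [hval, ← Finset.sum_range_reflect]
    refine Finset.sum_congr rfl fun m hm => ?_
    have hm' : m ≤ n := Nat.le_of_lt_succ (Finset.mem_range.1 hm)
    simp only [Nat.add_sub_cancel, Nat.sub_sub_self hm', dotProduct_comm]

/-- Feasible points of step programs can be replaced by bounded ones. -/
theorem step_exists_bounded (A : Matrix K J ℝ) (n : ℕ) :
    ∃ C : ℝ, 0 ≤ C ∧ ∀ (r : ℕ → K → ℝ) (g : ℕ → J → ℝ) (R : ℝ), 0 ≤ R →
      (∀ k ≤ n, ∀ i, |r k i| ≤ R) →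
      (∀ d : ℕ → J → ℝ, (∀ l, 0 ≤ d l) →
        (∀ k ≤ n, A.mulVec (∑ l ∈ Finset.range (k + 1), d l) ≤ 0) →
        ∑ l ∈ Finset.range (n + 1), g l ⬝ᵥ d l ≤ 0) →
      ∀ u : ℕ → J → ℝ, (∀ l, 0 ≤ u l) →
        (∀ k ≤ n, A.mulVec (∑ l ∈ Finset.range (k + 1), u l) ≤ r k) →
        ∃ v : ℕ → J → ℝ, (∀ l, 0 ≤ v l) ∧
          (∀ k ≤ n, A.mulVec (∑ l ∈ Finset.range (k + 1), v l) ≤ r k) ∧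
          (∀ l j, v l j ≤ C * R) ∧
          ∑ l ∈ Finset.range (n + 1), g l ⬝ᵥ u l ≤ ∑ l ∈ Finset.range (n + 1), g l ⬝ᵥ v l := by
  obtain ⟨C, hC0, hC⟩ := exists_bounded_feasible (stepMatrix A n)
  have feas_iff := stepMatrix_mulVec_le_iff A n
  refine ⟨C, hC0, fun r g R hR hrR hg u hu hur => ?_⟩
  obtain ⟨y, hy, hyr, hgy, hyC⟩ := hC (segment n r) (segment n g) (by
    intro d hd hd0
    obtain ⟨e, he, rfl⟩ := exists_segment_eq n d hd
    rw [segment_dotProduct]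
    exact hg e he ((feas_iff (fun _ => 0) e).1 hd0)) (segment n u) (fun q => hu _ _)
    ((feas_iff r u).2 hur)
  have hy' : ∀ q, y q ≤ C * R := fun q => (hyC q).trans (mul_le_mul_of_nonneg_left
    ((pi_norm_le_iff_of_nonneg hR).2 fun q => hrR _ (Nat.le_of_lt_succ q.1.2) _) hC0)
  let v : ℕ → J → ℝ := fun l j => if h : l < n + 1 then y (⟨l, h⟩, j) else 0
  have hv : segment n v = y := by
    ext ⟨l, i⟩
    simp [segment, v, Nat.lt_succ_iff.1 l.2]
  refine ⟨v, fun l j => ?_, (feas_iff r v).1 (hv ▸ hyr), fun l j => ?_, ?_⟩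
  · simp only [v]
    split_ifs
    · exact hy _
    · exact le_rfl
  · simp only [v]
    split_ifs
    · exact hy' _
    · positivity
  · rw [← hv, segment_dotProduct, segment_dotProduct] at hgy
    exact hgy

/-- Summation by parts: a sum of a nonincreasing nonnegative sequence against a sequence with
nonpositive partial sums is nonpositive. -/
theorem sum_dotProduct_nonpos {ι : Type*} [Fintype ι] (n : ℕ) (y z : ℕ → ι → ℝ)
    (hy : ∀ l ≤ n, 0 ≤ y l) (hanti : ∀ l < n, y (l + 1) ≤ y l)
    (hz : ∀ k ≤ n, ∑ l ∈ Finset.range (k + 1), z l ≤ 0) :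
    ∑ l ∈ Finset.range (n + 1), y l ⬝ᵥ z l ≤ 0 := by
  have key : ∀ k ≤ n, ∑ l ∈ Finset.range (k + 1), y l ⬝ᵥ z l ≤
      y k ⬝ᵥ ∑ l ∈ Finset.range (k + 1), z l := by
    intro k
    induction k with
    | zero => intro _; simp
    | succ k ih =>
      intro hk
      rw [Finset.sum_range_succ, Finset.sum_range_succ _ (k + 1), dotProduct_add]
      gcongr
      refine (ih (by omega)).trans ?_
      have h1 := dotProduct_le_dotProduct_of_nonneg_right (hanti k (by omega))
        (neg_nonneg.2 (hz k (by omega)))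
      rw [dotProduct_neg, dotProduct_neg] at h1
      linarith
  refine (key n le_rfl).trans ?_
  have h1 := dotProduct_nonneg_of_nonneg (hy n le_rfl) (neg_nonneg.2 (hz n le_rfl))
  rw [dotProduct_neg] at h1
  linarith

end StepPrograms

/-! ### Complementary slackness on a grid and the bound on the number of rates -/

section GridPrograms

variable {K J : Type*} [Fintype K] [Fintype J]

/-- The slack at time `n * h` in the constraints of M-CLP, of the control that has the increments
`u l` at the times `l * h`. -/
def slack {K J : Type*} [Fintype J] (A : Matrix K J ℝ) (β b : K → ℝ) (h : ℝ) (u : ℕ → J → ℝ)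
    (n : ℕ) : K → ℝ :=
  β + ((n : ℝ) * h) • b - A.mulVec (∑ l ∈ Finset.range (n + 1), u l)

theorem slack_succ {K J : Type*} [Fintype J] (A : Matrix K J ℝ) (β b : K → ℝ) (h : ℝ)
    (u : ℕ → J → ℝ) (n : ℕ) :
    slack A β b h u (n + 1) = slack A β b h u n + h • b - A.mulVec (u (n + 1)) := by
  ext i
  simp only [slack, Finset.sum_range_succ _ (n + 1), Matrix.mulVec_add, Nat.cast_add,
    Nat.cast_one, Pi.add_apply, Pi.sub_apply, Pi.smul_apply, smul_eq_mul]
  ring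

/-- A pair of feasible sequences of increments for the restrictions of M-CLP and M-CLP* to the
grid `0, h, …, N * h`, with complementary slackness and equal objective values. -/
structure GridPair (A : Matrix K J ℝ) (β b : K → ℝ) (γ c : J → ℝ) (h : ℝ) (N : ℕ)
    (u : ℕ → J → ℝ) (p : ℕ → K → ℝ) : Prop where
  nonneg : ∀ n, 0 ≤ u n
  dual_nonneg : ∀ n, 0 ≤ p n
  slack_nonneg : ∀ n ≤ N, 0 ≤ slack A β b h u n
  dual_slack_nonneg : ∀ n ≤ N, 0 ≤ slack (-A.transpose) (-γ) (-c) h p n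
  compl : ∀ n ≤ N, ∀ j, u n j * slack (-A.transpose) (-γ) (-c) h p (N - n) j = 0
  dual_compl : ∀ n ≤ N, ∀ i, p n i * slack A β b h u (N - n) i = 0
  value_eq : ∑ n ∈ Finset.range (N + 1), (γ + (((N : ℝ) - n) * h) • c) ⬝ᵥ u n =
    ∑ n ∈ Finset.range (N + 1), (β + (((N : ℝ) - n) * h) • b) ⬝ᵥ p n

variable {A : Matrix K J ℝ} {β b : K → ℝ} {γ c : J → ℝ} {h : ℝ} {N : ℕ}
  {u : ℕ → J → ℝ} {p : ℕ → K → ℝ}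

/-- Negating the data and exchanging the problems preserves grid pairs, so each estimate on u yields
one on p. -/
theorem GridPair.swap (H : GridPair A β b γ c h N u p) :
    GridPair (-A.transpose) (-γ) (-c) (-β) (-b) h N p u where
  nonneg := H.dual_nonneg
  dual_nonneg := H.nonneg
  slack_nonneg := H.dual_slack_nonneg
  dual_slack_nonneg := by simpa using H.slack_nonneg
  compl := by simpa using H.dual_compl
  dual_compl := H.compl
  value_eq := by
    simp only [smul_neg, ← neg_add, neg_dotProduct, Finset.sum_neg_distrib, H.value_eq]

/-- Consecutive dual slacks differ by Aᵀp_{k+1} - h c. Complementarity of w ≥ 0 to one of them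
removes its term and the other has a sign, whence the one-sided bounds below. -/
theorem GridPair.smul_dotProduct_eq (h : ℝ) (p : ℕ → K → ℝ) (w : J → ℝ) (k : ℕ) :
    h * (c ⬝ᵥ w) = p (k + 1) ⬝ᵥ A.mulVec w + slack (-A.transpose) (-γ) (-c) h p k ⬝ᵥ w -
      slack (-A.transpose) (-γ) (-c) h p (k + 1) ⬝ᵥ w := by
  rw [slack_succ, Matrix.dotProduct_mulVec, Matrix.neg_mulVec, Matrix.mulVec_transpose]
  simp only [sub_dotProduct, add_dotProduct, neg_dotProduct, smul_dotProduct, smul_eq_mul]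
  ring

theorem dotProduct_eq_zero_of_compl {x y : J → ℝ} (hxy : ∀ j, y j * x j = 0) : x ⬝ᵥ y = 0 :=
  Finset.sum_eq_zero fun j _ => by rw [mul_comm]; exact hxy j

theorem GridPair.rate_le (H : GridPair A β b γ c h N u p) {w : J → ℝ} (hw : 0 ≤ w) {k : ℕ}
    (hk : k < N) (hc : ∀ j, w j * slack (-A.transpose) (-γ) (-c) h p k j = 0) :
    h * (c ⬝ᵥ w) ≤ p (k + 1) ⬝ᵥ A.mulVec w := by
  have h1 := dotProduct_nonneg_of_nonneg (H.dual_slack_nonneg (k + 1) hk) hw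
  rw [GridPair.smul_dotProduct_eq (A := A) (γ := γ) h p w k, dotProduct_eq_zero_of_compl hc]
  linarith

theorem GridPair.le_rate (H : GridPair A β b γ c h N u p) {w : J → ℝ} (hw : 0 ≤ w) {k : ℕ}
    (hk : k < N) (hc : ∀ j, w j * slack (-A.transpose) (-γ) (-c) h p (k + 1) j = 0) :
    p (k + 1) ⬝ᵥ A.mulVec w ≤ h * (c ⬝ᵥ w) := by
  have h1 := dotProduct_nonneg_of_nonneg (H.dual_slack_nonneg k hk.le) hw
  rw [GridPair.smul_dotProduct_eq (A := A) (γ := γ) h p w k, dotProduct_eq_zero_of_compl hc]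
  linarith

theorem GridPair.dual_rate_ge (H : GridPair A β b γ c h N u p) {w : K → ℝ} (hw : 0 ≤ w) {k : ℕ}
    (hk : k < N) (hc : ∀ i, w i * slack A β b h u k i = 0) :
    w ⬝ᵥ A.mulVec (u (k + 1)) ≤ h * (b ⬝ᵥ w) := by
  have h1 := H.swap.rate_le hw hk (by simpa using hc)
  rw [Matrix.neg_mulVec, neg_dotProduct, dotProduct_neg, Matrix.mulVec_transpose,
    dotProduct_comm (u _), ← Matrix.dotProduct_mulVec] at h1
  linarith

theorem GridPair.dual_rate_le (H : GridPair A β b γ c h N u p) {w : K → ℝ} (hw : 0 ≤ w) {k : ℕ}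
    (hk : k < N) (hc : ∀ i, w i * slack A β b h u (k + 1) i = 0) :
    h * (b ⬝ᵥ w) ≤ w ⬝ᵥ A.mulVec (u (k + 1)) := by
  have h1 := H.swap.le_rate hw hk (by simpa using hc)
  rw [Matrix.neg_mulVec, neg_dotProduct, dotProduct_neg, Matrix.mulVec_transpose,
    dotProduct_comm (u _), ← Matrix.dotProduct_mulVec] at h1
  linarith

/-- The term p (N - n) ⬝ᵥ A u n separates the two rates: each factor is complementary to the slack
at the later end of the other's step. -/
theorem GridPair.dual_rate_le_rate (H : GridPair A β b γ c h N u p) {n : ℕ} (hn : 1 ≤ n)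
    (hnN : n < N) : h * (b ⬝ᵥ p (N - n)) ≤ h * (c ⬝ᵥ u n) := by
  obtain ⟨k, rfl⟩ : ∃ k, n = k + 1 := ⟨n - 1, by omega⟩
  obtain ⟨m, hm⟩ : ∃ m, N - (k + 1) = m + 1 := ⟨N - (k + 1) - 1, by omega⟩
  have h1 := H.dual_rate_le (H.dual_nonneg (N - (k + 1))) (k := k) (by omega) (by
    have := H.dual_compl (N - (k + 1)) (by omega)
    rwa [Nat.sub_sub_self hnN.le] at this)
  have h2 := H.le_rate (H.nonneg (k + 1)) (k := m) (by omega) (by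
    have := H.compl (k + 1) (by omega)
    rwa [hm] at this)
  rw [← hm] at h2
  exact h1.trans h2

/-- In p (N - n) ⬝ᵥ A u (n + 1) each factor is complementary to the slack at the earlier end of the
other's step, which reverses both bounds. -/
theorem GridPair.rate_succ_le_dual_rate (H : GridPair A β b γ c h N u p) {n : ℕ}
    (hnN : n < N) : h * (c ⬝ᵥ u (n + 1)) ≤ h * (b ⬝ᵥ p (N - n)) := by
  obtain ⟨m, hm⟩ : ∃ m, N - n = m + 1 := ⟨N - n - 1, by omega⟩
  have h1 := H.dual_rate_ge (H.dual_nonneg (N - n)) (k := n) (by omega) (by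
    have := H.dual_compl (N - n) (by omega)
    rwa [Nat.sub_sub_self hnN.le] at this)
  have h2 := H.rate_le (H.nonneg (n + 1)) (k := m) (by omega) (by
    have := H.compl (n + 1) (by omega)
    rwa [show N - (n + 1) = m by omega] at this)
  rw [← hm] at h2
  exact h2.trans h1

/-- The rates of growth of `cᵀ U` are nonincreasing on the grid. -/
theorem GridPair.rate_antitone (H : GridPair A β b γ c h N u p) {n m : ℕ} (hn : 1 ≤ n)
    (hnm : n ≤ m) (hm : m ≤ N) : h * (c ⬝ᵥ u m) ≤ h * (c ⬝ᵥ u n) := by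
  induction m, hnm using Nat.le_induction with
  | base => exact le_rfl
  | succ k hk ih =>
    exact ((H.rate_succ_le_dual_rate (by omega)).trans
      (H.dual_rate_le_rate (by omega) (by omega))).trans (ih (by omega))

/-- The rates of growth of `cᵀ U` are constant between two recurrences of the same pattern of
positive rates and positive slacks. -/
theorem GridPair.rate_const (H : GridPair A β b γ c h N u p) {n m : ℕ} (hn : 1 ≤ n)
    (hnm : n < m) (hm : m ≤ N) (hu : ∀ j, u n j ≠ 0 → u m j ≠ 0)
    (hx : ∀ i, slack A β b h u (n - 1) i ≠ 0 → slack A β b h u (m - 1) i ≠ 0)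
    {k : ℕ} (hnk : n ≤ k) (hkm : k < m) : h * (c ⬝ᵥ u k) = h * (c ⬝ᵥ u n) := by
  refine le_antisymm (H.rate_antitone hn hnk (by omega)) ?_
  -- The cycle closes through cᵀu_n ≤ bᵀp_{N-(m-1)} ≤ cᵀu_{m-1} ≤ cᵀu_k, up to the factor h. For its
  -- first link, the support inclusions make u_n complementary to the dual slack at N - m, as u_m
  -- is, and p_{N-(m-1)} complementary to the slack at n - 1, as it is to that at m - 1.
  refine le_trans ?_ (H.rate_antitone (n := k) (m := m - 1) (by omega) (by omega) (by omega))
  refine le_trans ?_ (H.dual_rate_le_rate (n := m - 1) (by omega) (by omega))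
  obtain ⟨l, hl⟩ : ∃ l, N - (m - 1) = l + 1 := ⟨N - m, by omega⟩
  obtain ⟨n, rfl⟩ : ∃ n', n = n' + 1 := ⟨n - 1, by omega⟩
  have h1 := H.rate_le (H.nonneg (n + 1)) (k := l) (by omega) (fun j => by
    have := H.compl m hm j
    rw [show N - m = l by omega] at this
    rcases mul_eq_zero.1 this with h0 | h0
    · rw [not_imp_not.1 (hu j) h0, zero_mul]
    · rw [h0, mul_zero])
  have h2 := H.dual_rate_ge (H.dual_nonneg (l + 1)) (k := n) (by omega) (fun i => by
    have := H.dual_compl (l + 1) (by omega) i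
    rw [show N - (l + 1) = m - 1 by omega] at this
    rcases mul_eq_zero.1 this with h0 | h0
    · rw [h0, zero_mul]
    · rw [show slack A β b h u n i = 0 from not_imp_not.1 (hx i) h0, mul_zero])
  rw [hl]
  exact h1.trans h2

/-- A sequence that is constant between recurrences of the same value of a pattern is constant
on each piece of a partition whose size is bounded by twice the number of patterns. -/
theorem exists_breakpoints {σ : Type*} (f : ℕ → σ) (g : ℕ → ℝ) (N : ℕ)
    (hfg : ∀ n m, 1 ≤ n → n < m → m ≤ N → f n = f m → ∀ k, n ≤ k → k < m → g k = g n)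
    (S : Finset σ) (a : ℕ) (ha : a ≤ N) (hS : ∀ n, a < n → n ≤ N → f n ∈ S) :
    ∃ ν : ℕ → ℕ, Monotone ν ∧ ν 0 = a ∧ ν (2 * S.card) = N ∧ (∀ i, ν i ≤ N) ∧
      ∀ i, ∃ ρ, ∀ n, ν i < n → n ≤ ν (i + 1) → g n = ρ := by
  classical
  induction hcard : S.card generalizing S a with
  | zero =>
    have haN : a = N := by
      by_contra hne
      have := hS (a + 1) (by omega) (by omega)
      rw [Finset.card_eq_zero.1 hcard] at this
      simp at this
    exact ⟨fun _ => a, monotone_const, rfl, haN, fun _ => ha,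
      fun i => ⟨0, fun n h1 h2 => absurd h2 (not_le.2 h1)⟩⟩
  | succ r ih =>
    rcases ha.eq_or_lt with haN | haN
    · exact ⟨fun _ => a, monotone_const, rfl, haN, fun _ => ha,
        fun i => ⟨0, fun n h1 h2 => absurd h2 (not_le.2 h1)⟩⟩
    have hne : ((Finset.Ioc a N).filter fun m => f m = f (a + 1)).Nonempty :=
      ⟨a + 1, by simp; omega⟩
    -- The last occurrence m of the pattern of a + 1. The rate is constant on (a, m - 1] but not
    -- controlled at m, so {m} is a piece of its own: two pieces per pattern, which never recurs
    -- after m.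
    obtain ⟨m, hm, hmax⟩ := Finset.exists_max_image _ id hne
    simp only [Finset.mem_filter, Finset.mem_Ioc, id, and_imp] at hm hmax
    obtain ⟨ν, hmono, h0, hN, hle, hconst⟩ := ih (S.erase (f (a + 1))) m hm.1.2
      (fun n h1 h2 => Finset.mem_erase.2 ⟨fun h3 => by
        have := hmax n (by omega) h2 h3
        omega, hS n (by omega) h2⟩)
      (by rw [Finset.card_erase_of_mem (hS _ (by omega) (by omega)), hcard]; rfl)
    refine ⟨fun i => match i with | 0 => a | 1 => m - 1 | i + 2 => ν i,
      monotone_nat_of_le_succ ?_, rfl, hN, ?_, ?_⟩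
    · rintro (_ | _ | i)
      · change a ≤ m - 1; omega
      · change m - 1 ≤ ν 0; omega
      · exact hmono (Nat.le_succ i)
    · rintro (_ | _ | i)
      · exact ha
      · change m - 1 ≤ N; omega
      · exact hle i
    · rintro (_ | _ | i)
      · refine ⟨g (a + 1), fun n h1 h2 => ?_⟩
        change n ≤ m - 1 at h2
        change a < n at h1
        exact hfg (a + 1) m (by omega) (by omega) hm.1.2 hm.2.symm n h1 (by omega)
      · refine ⟨g m, fun n h1 h2 => ?_⟩
        change n ≤ ν 0 at h2
        change m - 1 < n at h1
        rw [show n = m by omega]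
      · exact hconst i

/-- The grid is partitioned into a number of pieces that is bounded independently of the grid,
with a constant rate of growth of `cᵀ U` on each piece. -/
theorem GridPair.exists_breakpoints (H : GridPair A β b γ c h N u p) :
    ∃ ν : ℕ → ℕ, Monotone ν ∧ ν 0 = 0 ∧ ν (2 * Nat.card (Set J × Set K)) = N ∧ (∀ i, ν i ≤ N) ∧
      ∀ i, ∃ ρ, ∀ n, ν i < n → n ≤ ν (i + 1) → h * (c ⬝ᵥ u n) = ρ := by
  classical
  have := MCLP.exists_breakpoints
    (fun n => ({j | u n j ≠ 0}, {i | slack A β b h u (n - 1) i ≠ 0}))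
    (fun n => h * (c ⬝ᵥ u n)) N (fun n m hn hnm hm hf k hnk hkm => by
      obtain ⟨h1, h2⟩ := Prod.mk.inj hf
      exact H.rate_const hn hnm hm (fun j hj => h1.subset hj) (fun i hi => h2.subset hi) hnk hkm)
    Finset.univ 0 (Nat.zero_le N) (fun n _ _ => Finset.mem_univ _)
  rwa [Finset.card_univ, ← Nat.card_eq_fintype_card] at this

end GridPrograms

/-! ### Collapsing grid solutions to boundedly many pieces; compactness -/

section StepControls

variable {K J : Type*} [Fintype K] [Fintype J]

/-- The objective value of the piecewise linear control that starts with a jump `v 0` and has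
the increment `v l` over the time interval `[τ (l - 1), τ l]`. -/
noncomputable def stepValue {J : Type*} [Fintype J] (γ c : J → ℝ) (T : ℝ) (M : ℕ) (τ : ℕ → ℝ)
    (v : ℕ → J → ℝ) :
    ℝ :=
  -- Truncated subtraction makes both endpoints τ 0 at l = 0, so that v 0 is weighted as a jump
  -- there.
  ∑ l ∈ Finset.range (M + 1), (γ + (T - (τ (l - 1) + τ l) / 2) • c) ⬝ᵥ v l

/-- The breakpoints and increments of feasible piecewise linear controls with at most `M` pieces
and with increments bounded by `C`. -/
def stepSet {K J : Type*} [Fintype J] (A : Matrix K J ℝ) (β b : K → ℝ) (T : ℝ) (M : ℕ) (C : ℝ) :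
    Set ((ℕ → ℝ) × (ℕ → J → ℝ)) :=
  {q | Monotone q.1 ∧ q.1 0 = 0 ∧ q.1 M = T ∧ (∀ l, q.1 l ≤ T) ∧ (∀ l, 0 ≤ q.2 l) ∧
    (∀ l j, q.2 l j ≤ C) ∧
    ∀ k ≤ M, A.mulVec (∑ l ∈ Finset.range (k + 1), q.2 l) ≤ β + q.1 k • b}

/-- The mean of n over (a, e] is (a + e + 1) / 2; the extra 1 is the source of the shift h / 2
below. -/
theorem sum_Ioc_sub_mul (N ρ : ℝ) {a e : ℕ} (hae : a ≤ e) :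
    ∑ n ∈ Finset.Ioc a e, (N - n) * ρ = (N - (a + e + 1) / 2) * ((e - a) * ρ) := by
  induction e, hae using Nat.le_induction with
  | base => simp
  | succ k hk ih =>
    rw [← Finset.insert_Ioc_right_eq_Ioc_add_one (by omega), Finset.sum_insert (by simp), ih]
    push_cast
    ring

/-- On a piece with constant rate of growth of `cᵀ U`, the discrete objective depends on the total
increment only. -/
theorem dotProduct_sum_Ioc (γ c : J → ℝ) {T h ρ : ℝ} {N a e : ℕ} (u : ℕ → J → ℝ) (hh : 0 ≤ h)
    (hT : T = N * h) (hae : a ≤ e) (heN : e ≤ N)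
    (hρ : ∀ n, a < n → n ≤ e → h * (c ⬝ᵥ u n) = ρ) :
    (γ + max 0 (T - (a * h + e * h) / 2 - h / 2) • c) ⬝ᵥ ∑ n ∈ Finset.Ioc a e, u n =
      ∑ n ∈ Finset.Ioc a e, (γ + (((N : ℝ) - n) * h) • c) ⬝ᵥ u n := by
  rcases hae.eq_or_lt with rfl | hlt
  · simp
  have h1 : T - (a * h + e * h) / 2 - h / 2 = (N - ((a : ℝ) + e + 1) / 2) * h := by
    rw [hT]; ring
  have h2 : 0 ≤ (N : ℝ) - ((a : ℝ) + e + 1) / 2 := by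
    have h3 : (a : ℝ) + 1 ≤ e := by exact_mod_cast hlt
    have h4 : (e : ℝ) ≤ N := by exact_mod_cast heN
    linarith
  rw [h1, max_eq_right (mul_nonneg h2 hh)]
  simp only [add_dotProduct, smul_dotProduct, Finset.sum_add_distrib, dotProduct_sum, smul_eq_mul]
  congr 1
  have h5 : ∀ n ∈ Finset.Ioc a e, h * (c ⬝ᵥ u n) = ρ := fun n hn =>
    hρ n (Finset.mem_Ioc.1 hn).1 (Finset.mem_Ioc.1 hn).2
  have h6 : ∑ n ∈ Finset.Ioc a e, ((N : ℝ) - n) * h * (c ⬝ᵥ u n) =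
      ∑ n ∈ Finset.Ioc a e, ((N : ℝ) - n) * ρ :=
    Finset.sum_congr rfl fun n hn => by rw [mul_assoc, h5 n hn]
  rw [h6, sum_Ioc_sub_mul _ _ hae, ← Finset.mul_sum, mul_assoc, Finset.mul_sum,
    Finset.sum_congr rfl h5, Finset.sum_const, Nat.card_Ioc, nsmul_eq_mul, Nat.cast_sub hae]

theorem sum_sum_Ioc {E : Type*} [AddCommMonoid E] (f : ℕ → E) (ν : ℕ → ℕ) (hν : Monotone ν)
    (k : ℕ) :
    ∑ i ∈ Finset.range k, ∑ n ∈ Finset.Ioc (ν i) (ν (i + 1)), f n =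
      ∑ n ∈ Finset.Ioc (ν 0) (ν k), f n := by
  induction k with
  | zero => simp
  | succ k ih =>
    rw [Finset.sum_range_succ, ih,
      Finset.sum_Ioc_consecutive f (hν (Nat.zero_le k)) (hν (Nat.le_succ k))]

theorem add_sum_Ioc_zero {E : Type*} [AddCommMonoid E] (f : ℕ → E) (k : ℕ) :
    f 0 + ∑ n ∈ Finset.Ioc 0 k, f n = ∑ n ∈ Finset.range (k + 1), f n := by
  induction k with
  | zero => simp
  | succ k ih =>
    rw [Finset.sum_range_succ, ← ih, ← Finset.insert_Ioc_right_eq_Ioc_add_one (Nat.zero_le k),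
      Finset.sum_insert (by simp), add_comm (f (k + 1)), add_assoc]

/-- The weights of the discrete objective are nonpositive on the recession cone. -/
theorem sum_weights_nonpos {A : Matrix K J ℝ} {γ c : J → ℝ} {T : ℝ} {P : Control K T}
    (hP : DualFeasible A γ c P) (M : ℕ) (s : ℕ → ℝ) (hs : ∀ l, s l ∈ Icc 0 T) (hanti : Antitone s)
    (d : ℕ → J → ℝ) (hd : ∀ l, 0 ≤ d l)
    (hd0 : ∀ k ≤ M, A.mulVec (∑ l ∈ Finset.range (k + 1), d l) ≤ 0) :
    ∑ l ∈ Finset.range (M + 1), (γ + s l • c) ⬝ᵥ d l ≤ 0 := by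
  refine le_trans (Finset.sum_le_sum fun l _ => ?_)
    (sum_dotProduct_nonpos M (fun l => P ⟨s l, hs l⟩) (fun l => A.mulVec (d l))
      (fun l _ => P.nonneg' _) (fun l _ => P.mono' (hanti (Nat.le_succ l))) fun k hk => ?_)
  · rw [Matrix.dotProduct_mulVec, ← Matrix.mulVec_transpose]
    exact dotProduct_le_dotProduct_of_nonneg_right (hP ⟨s l, hs l⟩) (hd l)
  · rw [← Matrix.mulVec_sum]
    exact hd0 k hk

/-- An optimal solution on a grid with `N` steps gives a feasible piecewise linear control with
a bounded number of pieces, with bounded increments, and with almost the same objective. -/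
theorem exists_stepValue_ge (A : Matrix K J ℝ) (β b : K → ℝ) (γ c : J → ℝ) {T : ℝ} (hT : 0 ≤ T)
    {P : Control K T} (hP : DualFeasible A γ c P) :
    ∃ C : ℝ, ∀ (N : ℕ), 1 ≤ N → ∀ (u : ℕ → J → ℝ) (p : ℕ → K → ℝ),
      GridPair A β b γ c (T / N) N u p →
      ∃ q ∈ stepSet A β b T (2 * Nat.card (Set J × Set K)) C,
        ∑ n ∈ Finset.range (N + 1), (γ + (((N : ℝ) - n) * (T / N)) • c) ⬝ᵥ u n - C / N ≤
          stepValue γ c T (2 * Nat.card (Set J × Set K)) q.1 q.2 := by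
  set M := 2 * Nat.card (Set J × Set K) with hM
  obtain ⟨C₁, hC₁, hbound⟩ := step_exists_bounded A M
  set R : ℝ := ∑ i, (|β i| + T * |b i|) with hR
  have hR0 : 0 ≤ R := Finset.sum_nonneg fun i _ => by positivity
  set D : ℝ := T / 2 * ((M + 1) * ((∑ j, |c j|) * (C₁ * R))) with hD
  have hc0 : 0 ≤ ∑ j, |c j| := Finset.sum_nonneg fun j _ => abs_nonneg _
  have hD0 : 0 ≤ D := by positivity
  -- C₁ * R bounds the increments; D / N bounds the total of M + 1 errors, each h / 2 times a bound
  -- on |c ⬝ᵥ v l|.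
  refine ⟨max D (C₁ * R), fun N hN u p H => ?_⟩
  have hN0 : (0 : ℝ) < N := by exact_mod_cast hN
  set h : ℝ := T / N with hh
  have hh0 : 0 ≤ h := by positivity
  have hTN : T = N * h := by rw [hh]; field_simp
  obtain ⟨ν, hmono, hν0, hνM, hνN, hconst⟩ := H.exists_breakpoints
  rw [← hM] at hνM
  let τ : ℕ → ℝ := fun l => ν l * h
  have hτmono : Monotone τ := fun i j hij =>
    mul_le_mul_of_nonneg_right (by exact_mod_cast hmono hij) hh0
  have hτT : ∀ l, τ l ≤ T := fun l => by
    rw [hTN]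
    exact mul_le_mul_of_nonneg_right (by exact_mod_cast hνN l) hh0
  have hτ0 : τ 0 = 0 := by simp [τ, hν0]
  have hτnn : ∀ l, 0 ≤ τ l := fun l => hτ0 ▸ hτmono (Nat.zero_le l)
  -- The shift h / 2 makes the collapsed objective exact. Truncation at 0 can act only on empty
  -- pieces, and keeps s in [0, T], where P is defined.
  let s : ℕ → ℝ := fun l =>
    if l = 0 then T else max 0 (T - (τ (l - 1) + τ l) / 2 - h / 2)
  have hs_mem : ∀ l, s l ∈ Icc 0 T := by
    intro l
    simp only [s]
    split_ifs
    · exact ⟨hT, le_rfl⟩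
    · refine ⟨le_max_left _ _, max_le hT ?_⟩
      linarith [hτnn l, hτnn (l - 1)]
  have hs_anti : Antitone s := by
    refine antitone_nat_of_succ_le fun l => ?_
    by_cases hl : l = 0
    · have h1 : s l = T := if_pos hl
      rw [h1]
      exact (hs_mem _).2
    · simp only [s, if_neg hl, if_neg (Nat.succ_ne_zero l), Nat.add_sub_cancel]
      have h1 := hτmono (Nat.le_succ l)
      have h2 := hτmono (Nat.sub_le l 1)
      gcongr
  have hs_close : ∀ l, |s l - (T - (τ (l - 1) + τ l) / 2)| ≤ h / 2 := by
    intro l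
    by_cases hl : l = 0
    · have h1 : s l = T := if_pos hl
      rw [h1, hl]
      simp only [hτ0, Nat.zero_sub]
      simp
      positivity
    · simp only [s, if_neg hl]
      have h1 := hτT (l - 1)
      have h2 := hτT l
      rw [abs_le]
      constructor
      · linarith [le_max_right 0 (T - (τ (l - 1) + τ l) / 2 - h / 2)]
      · have := max_le (a := (0 : ℝ)) (b := T - (τ (l - 1) + τ l) / 2 - h / 2)
          (c := h / 2 + (T - (τ (l - 1) + τ l) / 2)) (by linarith) (by linarith)
        linarith
  let w : ℕ → J → ℝ := fun l =>
    match l with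
    | 0 => u 0
    | l + 1 => ∑ n ∈ Finset.Ioc (ν l) (ν (l + 1)), u n
  have hw0 : ∀ l, 0 ≤ w l := by
    rintro (_ | l)
    · exact H.nonneg 0
    · exact Finset.sum_nonneg fun n _ => H.nonneg n
  have hwsum : ∀ k, ∑ l ∈ Finset.range (k + 1), w l = ∑ n ∈ Finset.range (ν k + 1), u n := by
    intro k
    rw [Finset.sum_range_succ', add_comm]
    change u 0 + ∑ l ∈ Finset.range k, ∑ n ∈ Finset.Ioc (ν l) (ν (l + 1)), u n = _
    rw [sum_sum_Ioc u ν hmono k, hν0, add_sum_Ioc_zero]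
  have hwfeas : ∀ k ≤ M, A.mulVec (∑ l ∈ Finset.range (k + 1), w l) ≤ β + τ k • b := by
    intro k _
    rw [hwsum]
    exact sub_nonneg.1 (H.slack_nonneg (ν k) (hνN k))
  have hwval : ∑ l ∈ Finset.range (M + 1), (γ + s l • c) ⬝ᵥ w l =
      ∑ n ∈ Finset.range (N + 1), (γ + (((N : ℝ) - n) * h) • c) ⬝ᵥ u n := by
    rw [Finset.sum_range_succ', add_comm, ← add_sum_Ioc_zero]
    congr 1
    · simp [s, w, hTN]
    · rw [← hνM, ← hν0, ← sum_sum_Ioc _ ν hmono M]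
      refine Finset.sum_congr rfl fun l _ => ?_
      obtain ⟨ρ, hρ⟩ := hconst l
      have := dotProduct_sum_Ioc γ c u hh0 hTN (hmono (Nat.le_succ l)) (hνN _) hρ
      rw [hνM]
      exact this
  have hrR : ∀ k ≤ M, ∀ i, |(β + τ k • b) i| ≤ R := by
    intro k _ i
    calc |(β + τ k • b) i| ≤ |β i| + |τ k * b i| := abs_add_le _ _
      _ ≤ |β i| + T * |b i| := by
        rw [abs_mul, abs_of_nonneg (hτnn k)]
        gcongr
        exact hτT k
      _ ≤ R := Finset.single_le_sum (f := fun i => |β i| + T * |b i|)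
        (fun i _ => by positivity) (Finset.mem_univ i)
  obtain ⟨v, hv0, hvfeas, hvC, hvval⟩ := hbound (fun k => β + τ k • b) (fun l => γ + s l • c)
    R hR0 hrR (fun d hd hd0 => sum_weights_nonpos hP M s hs_mem hs_anti d hd hd0) w hw0 hwfeas
  refine ⟨(τ, v), ⟨hτmono, hτ0, ?_, hτT, hv0, fun l j => (hvC l j).trans (le_max_right _ _),
    hvfeas⟩, ?_⟩
  · simp only [τ, hνM]
    exact hTN.symm
  · rw [← hwval]
    have hterm : ∀ l, (γ + s l • c) ⬝ᵥ v l ≤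
        (γ + (T - (τ (l - 1) + τ l) / 2) • c) ⬝ᵥ v l + h / 2 * ((∑ j, |c j|) * (C₁ * R)) := by
      intro l
      have h1 : |c ⬝ᵥ v l| ≤ (∑ j, |c j|) * (C₁ * R) := by
        rw [dotProduct, Finset.sum_mul]
        refine (Finset.abs_sum_le_sum_abs _ _).trans (Finset.sum_le_sum fun j _ => ?_)
        rw [abs_mul, abs_of_nonneg (hv0 l j)]
        exact mul_le_mul_of_nonneg_left (hvC l j) (abs_nonneg _)
      have h2 : (s l - (T - (τ (l - 1) + τ l) / 2)) * (c ⬝ᵥ v l) ≤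
          h / 2 * ((∑ j, |c j|) * (C₁ * R)) := by
        refine (le_abs_self _).trans ?_
        rw [abs_mul]
        exact mul_le_mul (hs_close l) h1 (abs_nonneg _) (by positivity)
      simp only [add_dotProduct, smul_dotProduct, smul_eq_mul]
      linarith
    have h3 : ∑ l ∈ Finset.range (M + 1), (γ + s l • c) ⬝ᵥ v l ≤ stepValue γ c T M τ v + D / N := by
      refine (Finset.sum_le_sum fun l _ => hterm l).trans ?_
      rw [Finset.sum_add_distrib, stepValue]
      gcongr
      rw [Finset.sum_const, Finset.card_range, nsmul_eq_mul, hD, hh]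
      push_cast
      apply le_of_eq
      ring
    have h4 : D / N ≤ max D (C₁ * R) / N := by
      gcongr
      exact le_max_left _ _
    linarith

/-- The set of bounded feasible piecewise linear controls with a bounded number of pieces is
compact. -/
theorem isCompact_stepSet {K J : Type*} [Fintype J] (A : Matrix K J ℝ) (β b : K → ℝ) (T : ℝ)
    (M : ℕ) (C : ℝ) :
    IsCompact (stepSet A β b T M C) := by
  have hclosed : IsClosed (stepSet A β b T M C) := by
    have h1 : ∀ l : ℕ, Continuous fun q : (ℕ → ℝ) × (ℕ → J → ℝ) => q.1 l := fun l => by fun_prop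
    have h2 : ∀ l : ℕ, Continuous fun q : (ℕ → ℝ) × (ℕ → J → ℝ) => q.2 l := fun l => by fun_prop
    have h3 : IsClosed {q : (ℕ → ℝ) × (ℕ → J → ℝ) | Monotone q.1} := by
      have : {q : (ℕ → ℝ) × (ℕ → J → ℝ) | Monotone q.1} =
          ⋂ l : ℕ, {q | q.1 l ≤ q.1 (l + 1)} := by
        ext q
        simp only [mem_ofPred_eq, mem_iInter]
        exact ⟨fun h l => h (Nat.le_succ l), monotone_nat_of_le_succ⟩
      rw [this]
      exact isClosed_iInter fun l => isClosed_le (h1 l) (h1 (l + 1))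
    have h4 : IsClosed {q : (ℕ → ℝ) × (ℕ → J → ℝ) | ∀ l, q.1 l ≤ T} := by
      rw [ofPred_forall]
      exact isClosed_iInter fun l => isClosed_le (h1 l) continuous_const
    have h5 : IsClosed {q : (ℕ → ℝ) × (ℕ → J → ℝ) | ∀ l, 0 ≤ q.2 l} := by
      rw [ofPred_forall]
      exact isClosed_iInter fun l => isClosed_le continuous_const (h2 l)
    have h6 : IsClosed {q : (ℕ → ℝ) × (ℕ → J → ℝ) | ∀ l j, q.2 l j ≤ C} := by
      simp only [ofPred_forall]
      exact isClosed_iInter fun l => isClosed_iInter fun j =>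
        isClosed_le (by fun_prop) continuous_const
    have h7 : IsClosed {q : (ℕ → ℝ) × (ℕ → J → ℝ) | ∀ k ≤ M,
        A.mulVec (∑ l ∈ Finset.range (k + 1), q.2 l) ≤ β + q.1 k • b} := by
      simp only [ofPred_forall]
      refine isClosed_iInter fun k => isClosed_iInter fun _ => isClosed_le ?_ (by fun_prop)
      exact Continuous.matrix_mulVec continuous_const (continuous_finsetSum _ fun l _ => h2 l)
    exact h3.inter ((isClosed_eq (h1 0) continuous_const).inter
      ((isClosed_eq (h1 M) continuous_const).inter (h4.inter (h5.inter (h6.inter h7)))))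
  -- All coordinates are bounded, also those beyond M, so Tychonoff applies. Breakpoints may
  -- coincide in a limit, and the piece then becomes a jump.
  refine (((isCompact_univ_pi fun _ : ℕ => isCompact_Icc (a := (0 : ℝ)) (b := T)).prod
    (isCompact_univ_pi fun _ : ℕ => isCompact_univ_pi fun _ : J =>
      isCompact_Icc (a := (0 : ℝ)) (b := C))).of_isClosed_subset hclosed ?_)
  rintro q ⟨hmono, h0, -, hT, hv, hC, -⟩
  exact ⟨fun l _ => ⟨h0 ▸ hmono (Nat.zero_le l), hT l⟩, fun l _ j _ => ⟨hv l j, hC l j⟩⟩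

/-- The objective attains its maximum over the bounded feasible piecewise linear controls with
a bounded number of pieces. -/
theorem exists_isMaxOn_stepValue {K J : Type*} [Fintype J] (A : Matrix K J ℝ) (β b : K → ℝ)
    (γ c : J → ℝ) (T : ℝ) (M : ℕ)
    (C : ℝ) (hne : (stepSet A β b T M C).Nonempty) :
    ∃ q ∈ stepSet A β b T M C, ∀ q' ∈ stepSet A β b T M C,
      stepValue γ c T M q'.1 q'.2 ≤ stepValue γ c T M q.1 q.2 := by
  have hcont : Continuous fun q : (ℕ → ℝ) × (ℕ → J → ℝ) => stepValue γ c T M q.1 q.2 := by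
    unfold stepValue
    refine continuous_finsetSum _ fun l _ => Continuous.dotProduct ?_ ?_
    · fun_prop
    · fun_prop
  obtain ⟨q, hq, hmax⟩ := (isCompact_stepSet A β b T M C).exists_isMaxOn hne hcont.continuousOn
  exact ⟨q, hq, fun q' hq' => hmax hq'⟩

end StepControls

/-! ### Stieltjes integrals and weak duality -/

section Integrals

open Filter Topology

/-- Symmetry of the convolution pairing of two finite measures on the line. -/
theorem integral_measureReal_Iic_sub (μ ν : Measure ℝ) [IsFiniteMeasure μ] [IsFiniteMeasure ν]
    (T : ℝ) : ∫ s, μ.real (Iic (T - s)) ∂ν = ∫ t, ν.real (Iic (T - t)) ∂μ := by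
  have hanti : ∀ (ρ : Measure ℝ), Measurable fun s => ρ (Iic (T - s)) := fun ρ =>
    Antitone.measurable fun s t hst => measure_mono (Iic_subset_Iic.2 (by linarith))
  have hS : MeasurableSet {q : ℝ × ℝ | q.1 + q.2 ≤ T} :=
    measurableSet_le (by fun_prop) (by fun_prop)
  -- Both sides compute the product mass of {s + t ≤ T}.
  have h1 : ∫⁻ s, μ (Iic (T - s)) ∂ν = ν.prod μ {q : ℝ × ℝ | q.1 + q.2 ≤ T} := by
    rw [Measure.prod_apply hS]
    refine lintegral_congr fun s => ?_
    congr 1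
    ext t
    simp [le_sub_iff_add_le']
  have h2 : ∫⁻ t, ν (Iic (T - t)) ∂μ = ν.prod μ {q : ℝ × ℝ | q.1 + q.2 ≤ T} := by
    rw [Measure.prod_apply_symm hS]
    refine lintegral_congr fun t => ?_
    congr 1
    ext s
    simp [le_sub_iff_add_le]
  simp only [measureReal_def]
  rw [integral_toReal (hanti μ).aemeasurable (ae_of_all _ fun s => measure_lt_top _ _),
    integral_toReal (hanti ν).aemeasurable (ae_of_all _ fun s => measure_lt_top _ _), h1, h2]

variable {ι κ : Type*} {T : ℝ}

theorem Control.extend_of_mem (hT : 0 ≤ T) (U : Control ι T) (i : ι) {t : ℝ} (ht : t ∈ Icc 0 T) :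
    U.extend hT i t = U ⟨t, ht⟩ i := by
  change (if t < 0 then 0 else U (projIcc 0 T hT t) i) = _
  rw [if_neg (not_lt.2 ht.1), projIcc_of_mem hT ht]

theorem Control.extend_of_neg (hT : 0 ≤ T) (U : Control ι T) (i : ι) {t : ℝ} (ht : t < 0) :
    U.extend hT i t = 0 := if_pos ht

theorem Control.extend_nonneg (hT : 0 ≤ T) (U : Control ι T) (i : ι) (t : ℝ) :
    0 ≤ U.extend hT i t := by
  change 0 ≤ if t < 0 then 0 else U (projIcc 0 T hT t) i
  split_ifs
  · exact le_rfl
  · exact U.nonneg' _ i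

theorem Control.extend_le (hT : 0 ≤ T) (U : Control ι T) (i : ι) (t : ℝ) :
    U.extend hT i t ≤ U.extend hT i T := by
  rcases le_total t T with h | h
  · exact (U.extend hT i).mono h
  · refine le_of_eq ?_
    change (if t < 0 then 0 else U (projIcc 0 T hT t) i) =
      if T < 0 then 0 else U (projIcc 0 T hT T) i
    rw [if_neg (not_lt.2 (hT.trans h)), if_neg (not_lt.2 hT), projIcc_of_right_le hT h,
      projIcc_right]

instance (hT : 0 ≤ T) (U : Control ι T) (i : ι) : IsFiniteMeasure (U.extend hT i).measure :=
  (U.extend hT i).isFiniteMeasure_of_forall_abs_le (C := U.extend hT i T) fun t => by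
    rw [abs_of_nonneg (U.extend_nonneg hT i t)]
    exact U.extend_le hT i t

theorem Control.measureReal_Icc (hT : 0 ≤ T) (U : Control ι T) (i : ι) (r : ℝ) :
    (U.extend hT i).measure.real (Icc 0 r) = U.extend hT i r := by
  have h0 : Function.leftLim (U.extend hT i) 0 = 0 := by
    refine leftLim_eq_of_tendsto ?_
    refine (tendsto_const_nhds (x := (0 : ℝ))).congr' ?_
    filter_upwards [self_mem_nhdsWithin] with t ht
    exact (U.extend_of_neg hT i ht).symm
  rw [measureReal_def, StieltjesFunction.measure_Icc, h0, sub_zero,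
    ENNReal.toReal_ofReal (U.extend_nonneg hT i r)]

theorem Control.measureReal_restrict_Iic (hT : 0 ≤ T) (U : Control ι T) (i : ι) {s : ℝ}
    (hs : s ∈ Icc 0 T) :
    ((U.extend hT i).measure.restrict (Icc 0 T)).real (Iic (T - s)) = U.extend hT i (T - s) := by
  have h1 : Iic (T - s) ∩ Icc 0 T = Icc 0 (T - s) := by
    ext t
    simp only [mem_inter_iff, mem_Iic, mem_Icc]
    exact ⟨fun h => ⟨h.2.1, h.1⟩, fun h => ⟨h.2, h.1, by linarith [hs.1, h.2]⟩⟩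
  rw [measureReal_restrict_apply measurableSet_Iic, h1,
    U.measureReal_Icc hT i]

/-- Symmetry of the convolution pairing of two controls. -/
theorem Control.integral_extend_sub (hT : 0 ≤ T) (U : Control ι T) (P : Control κ T) (i : ι)
    (k : κ) :
    ∫ t in Icc 0 T, P.extend hT k (T - t) ∂(U.extend hT i).measure =
      ∫ s in Icc 0 T, U.extend hT i (T - s) ∂(P.extend hT k).measure := by
  have h := integral_measureReal_Iic_sub ((P.extend hT k).measure.restrict (Icc 0 T))
    ((U.extend hT i).measure.restrict (Icc 0 T)) T
  rwa [setIntegral_congr_fun measurableSet_Icc fun s hs => P.measureReal_restrict_Iic hT k hs,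
    setIntegral_congr_fun measurableSet_Icc fun s hs => U.measureReal_restrict_Iic hT i hs] at h

/-- Integration by parts, as the convolution symmetry with Lebesgue measure for one factor. -/
theorem Control.integral_sub (hT : 0 ≤ T) (U : Control ι T) (i : ι) :
    ∫ t in Icc 0 T, (T - t) ∂(U.extend hT i).measure = ∫ t in (0)..T, U.extend hT i t := by
  have h := integral_measureReal_Iic_sub (volume.restrict (Icc 0 T))
    ((U.extend hT i).measure.restrict (Icc 0 T)) T
  have h1 : ∀ s ∈ Icc 0 T, (volume.restrict (Icc 0 T)).real (Iic (T - s)) = T - s := by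
    intro s hs
    have h1 : Iic (T - s) ∩ Icc 0 T = Icc 0 (T - s) := by
      ext t
      simp only [mem_inter_iff, mem_Iic, mem_Icc]
      exact ⟨fun h => ⟨h.2.1, h.1⟩, fun h => ⟨h.2, h.1, by linarith [hs.1, h.2]⟩⟩
    rw [measureReal_restrict_apply measurableSet_Iic, h1, Real.volume_real_Icc_of_le
      (sub_nonneg.2 hs.2), sub_zero]
  rw [setIntegral_congr_fun measurableSet_Icc h1,
    setIntegral_congr_fun measurableSet_Icc fun s hs => U.measureReal_restrict_Iic hT i hs] at h
  rw [h, integral_Icc_eq_integral_Ioc, ← intervalIntegral.integral_of_le hT,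
    intervalIntegral.integral_comp_sub_left (fun t => U.extend hT i t) T, sub_self, sub_zero]

theorem Control.integrableOn_of_continuous (hT : 0 ≤ T) (U : Control ι T) (i : ι) {f : ℝ → ℝ}
    (hf : Continuous f) : IntegrableOn f (Icc 0 T) (U.extend hT i).measure :=
  hf.continuousOn.integrableOn_compact isCompact_Icc

theorem Control.integrableOn_extend_sub (hT : 0 ≤ T) (U : Control ι T) (P : Control κ T) (i : ι)
    (k : κ) :
    IntegrableOn (fun t => P.extend hT k (T - t)) (Icc 0 T) (U.extend hT i).measure := by
  have hanti : Antitone fun t => P.extend hT k (T - t) := fun s t hst =>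
    (P.extend hT k).mono (by linarith)
  refine Integrable.of_bound hanti.measurable.aestronglyMeasurable (P.extend hT k T)
    (ae_of_all _ fun t => ?_)
  rw [Real.norm_eq_abs, abs_of_nonneg (P.extend_nonneg hT k _)]
  exact P.extend_le hT k _

theorem objective_eq [Fintype ι] (hT : 0 ≤ T) (g d : ι → ℝ) (U : Control ι T) :
    objective hT g d U =
      ∑ i, (g i * U.extend hT i T + d i * ∫ t in (0)..T, U.extend hT i t) := by
  refine Finset.sum_congr rfl fun i _ => ?_
  rw [integral_add (U.integrableOn_of_continuous hT i continuous_const)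
    (U.integrableOn_of_continuous hT i (by fun_prop)), setIntegral_const, integral_mul_const,
    U.integral_sub hT i, U.measureReal_Icc hT i, smul_eq_mul]
  ring

variable {K J : Type*} [Fintype K] [Fintype J]

/-- Weak duality between M-CLP and M-CLP*. -/
theorem objective_le_objective (hT : 0 ≤ T) {A : Matrix K J ℝ} {β b : K → ℝ} {γ c : J → ℝ}
    {U : Control J T} {P : Control K T} (hU : PrimalFeasible A β b U)
    (hP : DualFeasible A γ c P) : objective hT γ c U ≤ objective hT β b P := by
  -- The dual constraint at T - t, the convolution symmetry, then the primal constraint at T - s.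
  calc objective hT γ c U
      ≤ ∑ j, ∫ t in Icc 0 T, ∑ k, A k j * P.extend hT k (T - t) ∂(U.extend hT j).measure := by
        refine Finset.sum_le_sum fun j _ => ?_
        refine setIntegral_mono_on (U.integrableOn_of_continuous hT j (by fun_prop))
          (integrable_finsetSum _ fun k _ =>
            (U.integrableOn_extend_sub hT P j k).const_mul _) measurableSet_Icc fun t ht => ?_
        have hmem : T - t ∈ Icc 0 T := ⟨by linarith [ht.2], by linarith [ht.1]⟩
        have h1 := hP ⟨T - t, hmem⟩ j
        simp only [P.extend_of_mem hT _ hmem]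
        exact h1
    _ = ∑ j, ∑ k, A k j * ∫ s in Icc 0 T, U.extend hT j (T - s) ∂(P.extend hT k).measure := by
        refine Finset.sum_congr rfl fun j _ => ?_
        rw [integral_finsetSum _ fun k _ => (U.integrableOn_extend_sub hT P j k).const_mul _]
        refine Finset.sum_congr rfl fun k _ => ?_
        rw [integral_const_mul, U.integral_extend_sub hT P j k]
    _ = ∑ k, ∫ s in Icc 0 T, ∑ j, A k j * U.extend hT j (T - s) ∂(P.extend hT k).measure := by
        rw [Finset.sum_comm]
        refine Finset.sum_congr rfl fun k _ => ?_
        rw [integral_finsetSum _ fun j _ => (P.integrableOn_extend_sub hT U k j).const_mul _]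
        exact Finset.sum_congr rfl fun j _ => (integral_const_mul _ _).symm
    _ ≤ objective hT β b P := by
        refine Finset.sum_le_sum fun k _ => ?_
        refine setIntegral_mono_on (integrable_finsetSum _ fun j _ =>
            (P.integrableOn_extend_sub hT U k j).const_mul _)
          (P.integrableOn_of_continuous hT k (by fun_prop)) measurableSet_Icc fun s hs => ?_
        have hmem : T - s ∈ Icc 0 T := ⟨by linarith [hs.2], by linarith [hs.1]⟩
        have h1 := hU ⟨T - s, hmem⟩ k
        simp only [U.extend_of_mem hT _ hmem]
        exact h1

end Integrals

/-! ### Uniform distribution functions -/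

section Ramps

open Filter Topology

/-- The distribution function of the uniform distribution on `[a, b]`, or of the unit mass at `a`
if `a = b`. -/
noncomputable def ramp (a b t : ℝ) : ℝ :=
  if t < a then 0 else if b ≤ t then 1 else (t - a) / (b - a)

theorem ramp_of_lt {a b t : ℝ} (h : t < a) : ramp a b t = 0 := if_pos h

theorem ramp_of_le {a b t : ℝ} (hab : a ≤ b) (h : b ≤ t) : ramp a b t = 1 := by
  rw [ramp, if_neg (not_lt.2 (hab.trans h)), if_pos h]

theorem ramp_of_mem {a b t : ℝ} (h1 : a ≤ t) (h2 : t < b) : ramp a b t = (t - a) / (b - a) := by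
  rw [ramp, if_neg (not_lt.2 h1), if_neg (not_le.2 h2)]

theorem ramp_nonneg (a b t : ℝ) : 0 ≤ ramp a b t := by
  unfold ramp
  split_ifs with h1 h2
  · exact le_rfl
  · exact zero_le_one
  · exact div_nonneg (by linarith) (by linarith)

theorem ramp_le_one (a b t : ℝ) : ramp a b t ≤ 1 := by
  unfold ramp
  split_ifs with h1 h2
  · exact zero_le_one
  · exact le_rfl
  · exact div_le_one_of_le₀ (by linarith) (by linarith)

theorem ramp_mono {a b : ℝ} (hab : a ≤ b) : Monotone (ramp a b) := by
  intro s t hst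
  rcases lt_or_ge s a with h1 | h1
  · rw [ramp_of_lt h1]
    exact ramp_nonneg a b t
  rcases le_or_gt b t with h2 | h2
  · rw [ramp_of_le hab h2]
    exact ramp_le_one a b s
  rw [ramp_of_mem h1 (hst.trans_lt h2), ramp_of_mem (h1.trans hst) h2]
  exact div_le_div_of_nonneg_right (by linarith) (by linarith)

theorem ramp_right_continuous {a b : ℝ} (hab : a ≤ b) (t : ℝ) :
    ContinuousWithinAt (ramp a b) (Ici t) t := by
  rcases lt_or_ge t a with h1 | h1
  · refine ContinuousAt.continuousWithinAt ((continuousAt_const (y := (0 : ℝ))).congr ?_)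
    filter_upwards [Iio_mem_nhds h1] with s hs
    exact (ramp_of_lt hs).symm
  rcases le_or_gt b t with h2 | h2
  · exact (continuousWithinAt_const (b := (1 : ℝ))).congr (fun s hs => ramp_of_le hab (h2.trans hs))
      (ramp_of_le hab h2)
  · have h3 : ContinuousWithinAt (fun s => (s - a) / (b - a)) (Ici t) t :=
      Continuous.continuousWithinAt (by fun_prop)
    refine h3.congr_of_eventuallyEq ?_ (ramp_of_mem h1 h2)
    filter_upwards [self_mem_nhdsWithin, mem_nhdsWithin_of_mem_nhds (Iio_mem_nhds h2)] with s hs hs'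
    exact ramp_of_mem (h1.trans hs) hs'

theorem integral_ramp {a b T : ℝ} (ha : 0 ≤ a) (hab : a ≤ b) (hb : b ≤ T) :
    ∫ t in (0)..T, ramp a b t = T - (a + b) / 2 := by
  have hint : ∀ x y : ℝ, IntervalIntegrable (ramp a b) volume x y := fun x y =>
    (ramp_mono hab).intervalIntegrable
  rw [← intervalIntegral.integral_add_adjacent_intervals (hint 0 a) (hint a T),
    ← intervalIntegral.integral_add_adjacent_intervals (hint a b) (hint b T),
    intervalIntegral.integral_congr_Ioo_of_le (g := fun _ => (0 : ℝ)) ha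
      (fun t ht => ramp_of_lt ht.2),
    intervalIntegral.integral_congr_Ioo_of_le (g := fun t => (t - a) / (b - a)) hab
      (fun t ht => ramp_of_mem ht.1.le ht.2),
    intervalIntegral.integral_congr_Ioo_of_le (g := fun _ => (1 : ℝ)) hb
      (fun t ht => ramp_of_le hab ht.1.le)]
  have h1 : ∫ t in a..b, (t - a) / (b - a) = (b - a) / 2 := by
    rw [intervalIntegral.integral_div, intervalIntegral.integral_sub (by simp) (by simp),
      integral_id, intervalIntegral.integral_const, smul_eq_mul]
    rcases hab.eq_or_lt with rfl | hlt
    · simp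
    · have : b - a ≠ 0 := by linarith
      field_simp
      ring
  rw [h1]
  simp
  ring

end Ramps

/-! ### Piecewise linear controls -/

section StepControls

variable {K J : Type*} [Fintype J]

/-- The piecewise linear control that starts with a jump `v 0` and has the increment `v l` over
the time interval `[τ (l - 1), τ l]`. -/
noncomputable def stepControl {J : Type*} {T : ℝ} (M : ℕ) (τ : ℕ → ℝ) (hτ : Monotone τ)
    (v : ℕ → J → ℝ) (hv : ∀ l, 0 ≤ v l) : Control J T where
  toFun t := ∑ l ∈ Finset.range (M + 1), ramp (τ (l - 1)) (τ l) t • v l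
  nonneg' t := Finset.sum_nonneg fun l _ => smul_nonneg (ramp_nonneg _ _ _) (hv l)
  mono' s t hst := Finset.sum_le_sum fun l _ =>
    smul_le_smul_of_nonneg_right (ramp_mono (hτ (Nat.sub_le l 1)) hst) (hv l)
  right_continuous' t := by
    refine tendsto_finsetSum _ fun l _ => Filter.Tendsto.smul_const ?_ _
    exact ContinuousWithinAt.comp (t := Ici (t : ℝ)) (g := ramp (τ (l - 1)) (τ l))
      (ramp_right_continuous (hτ (Nat.sub_le l 1)) t) continuous_subtype_val.continuousWithinAt
      (fun s hs => hs)

/-- Between distinct breakpoints both sides of the constraint are affine in t, so the inequalities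
at the breakpoints suffice. -/
theorem primalFeasible_stepControl {A : Matrix K J ℝ} {β b : K → ℝ} {T : ℝ} {M : ℕ} {C : ℝ}
    {q : (ℕ → ℝ) × (ℕ → J → ℝ)} (hq : q ∈ stepSet A β b T M C) :
    PrimalFeasible A β b (stepControl (T := T) M q.1 hq.1 q.2 hq.2.2.2.2.1) := by
  classical
  obtain ⟨τ, v⟩ := q
  obtain ⟨hτ, hτ0, hτM, hτT, hv, hC, hfeas⟩ := hq
  dsimp only at *
  intro t
  change A.mulVec (∑ l ∈ Finset.range (M + 1), ramp (τ (l - 1)) (τ l) t • v l) ≤ _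
  -- The last breakpoint not after t lies beyond all coinciding ones: their jumps are complete and,
  -- if k < M, the next piece has positive length.
  obtain ⟨k, ⟨hkM, hkt⟩, hmax⟩ : ∃ k, (k ≤ M ∧ τ k ≤ t) ∧ ∀ m ≤ M, τ m ≤ t → m ≤ k := by
    have hne : ((Finset.range (M + 1)).filter fun m => τ m ≤ t).Nonempty :=
      ⟨0, by simpa using hτ0.trans_le t.2.1⟩
    obtain ⟨k, hk, hmax⟩ := Finset.exists_max_image _ id hne
    simp only [Finset.mem_filter, Finset.mem_range, Nat.lt_succ_iff, id, and_imp] at hk hmax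
    exact ⟨k, hk, hmax⟩
  have hone : ∀ l ≤ k, ramp (τ (l - 1)) (τ l) t = 1 := fun l hl =>
    ramp_of_le (hτ (Nat.sub_le l 1)) ((hτ hl).trans hkt)
  have hV : ∑ l ∈ Finset.range (k + 1), ramp (τ (l - 1)) (τ l) t • v l =
      ∑ l ∈ Finset.range (k + 1), v l := Finset.sum_congr rfl fun l hl => by
    rw [hone l (Nat.le_of_lt_succ (Finset.mem_range.1 hl)), one_smul]
  rcases hkM.eq_or_lt with rfl | hlt
  · have htT : (t : ℝ) = T := le_antisymm t.2.2 (hτM ▸ hkt)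
    rw [hV, htT, ← hτM]
    exact hfeas k le_rfl
  · have htk : (t : ℝ) < τ (k + 1) := by
      by_contra! hcon
      have := hmax (k + 1) hlt hcon
      omega
    have hsum : ∑ l ∈ Finset.range (M + 1), ramp (τ (l - 1)) (τ l) t • v l =
        ∑ l ∈ Finset.range (k + 2), ramp (τ (l - 1)) (τ l) t • v l := by
      refine (Finset.sum_subset (Finset.range_mono (by omega)) fun l _ hl => ?_).symm
      have hl' : k + 1 ≤ l - 1 := by
        have := Finset.mem_range.not.1 hl
        omega
      rw [ramp_of_lt (htk.trans_le (hτ hl')), zero_smul]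
    have hdiff : 0 < τ (k + 1) - τ k := by linarith
    set r : ℝ := (t - τ k) / (τ (k + 1) - τ k) with hr
    have hr0 : 0 ≤ r := div_nonneg (by linarith) hdiff.le
    have hr1 : r ≤ 1 := div_le_one_of_le₀ (by linarith) hdiff.le
    have ht : (t : ℝ) = (1 - r) * τ k + r * τ (k + 1) := by
      have : r * (τ (k + 1) - τ k) = t - τ k := div_mul_cancel₀ _ hdiff.ne'
      linarith
    have hcomb : ∑ l ∈ Finset.range (M + 1), ramp (τ (l - 1)) (τ l) t • v l =
        (1 - r) • ∑ l ∈ Finset.range (k + 1), v l + r • ∑ l ∈ Finset.range (k + 2), v l := by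
      rw [hsum, Finset.sum_range_succ, hV, Finset.sum_range_succ v (k + 1), Nat.add_sub_cancel,
        ramp_of_mem hkt htk, ← hr]
      module
    rw [hcomb, Matrix.mulVec_add, Matrix.mulVec_smul, Matrix.mulVec_smul]
    have h1 := smul_le_smul_of_nonneg_left (hfeas k hkM) (sub_nonneg.2 hr1)
    have h2 := smul_le_smul_of_nonneg_left (hfeas (k + 1) hlt) hr0
    refine (add_le_add h1 h2).trans (le_of_eq ?_)
    rw [ht]
    module

/-- A ramp on [a, b] ends at 1 and integrates to T minus its midpoint, which produces the midpoint
weights. -/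
theorem objective_stepControl {A : Matrix K J ℝ} {β b : K → ℝ} {T : ℝ} (hT : 0 ≤ T) {M : ℕ}
    {C : ℝ} (γ c : J → ℝ) {q : (ℕ → ℝ) × (ℕ → J → ℝ)} (hq : q ∈ stepSet A β b T M C) :
    objective hT γ c (stepControl (T := T) M q.1 hq.1 q.2 hq.2.2.2.2.1) =
      stepValue γ c T M q.1 q.2 := by
  obtain ⟨τ, v⟩ := q
  obtain ⟨hτ, hτ0, hτM, hτT, hv, hC, hfeas⟩ := hq
  dsimp only at *
  have hval : ∀ j, ∀ t ∈ Icc 0 T, (stepControl (T := T) M τ hτ v hv).extend hT j t =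
      ∑ l ∈ Finset.range (M + 1), ramp (τ (l - 1)) (τ l) t * v l j := by
    intro j t ht
    rw [Control.extend_of_mem hT _ j ht]
    change (∑ l ∈ Finset.range (M + 1), ramp (τ (l - 1)) (τ l) t • v l) j = _
    rw [Finset.sum_apply]
    rfl
  have hend : ∀ j, (stepControl (T := T) M τ hτ v hv).extend hT j T =
      ∑ l ∈ Finset.range (M + 1), v l j := by
    intro j
    rw [hval j T (right_mem_Icc.2 hT)]
    exact Finset.sum_congr rfl fun l _ => by
      rw [ramp_of_le (hτ (Nat.sub_le l 1)) (hτT l), one_mul]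
  have hint : ∀ j, ∫ t in (0)..T, (stepControl (T := T) M τ hτ v hv).extend hT j t =
      ∑ l ∈ Finset.range (M + 1), (T - (τ (l - 1) + τ l) / 2) * v l j := by
    intro j
    rw [intervalIntegral.integral_congr (g := fun t =>
      ∑ l ∈ Finset.range (M + 1), ramp (τ (l - 1)) (τ l) t * v l j)
      (fun t ht => hval j t (by rwa [uIcc_of_le hT] at ht)),
      intervalIntegral.integral_finsetSum fun l _ =>
        ((ramp_mono (hτ (Nat.sub_le l 1))).intervalIntegrable).mul_const _]
    refine Finset.sum_congr rfl fun l _ => ?_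
    rw [intervalIntegral.integral_mul_const,
      integral_ramp (hτ0 ▸ hτ (Nat.zero_le _)) (hτ (Nat.sub_le l 1)) (hτT l)]
  rw [objective_eq, stepValue]
  simp only [hend, hint, Finset.mul_sum, ← Finset.sum_add_distrib, dotProduct]
  rw [Finset.sum_comm]
  refine Finset.sum_congr rfl fun l _ => Finset.sum_congr rfl fun j _ => ?_
  simp only [Pi.add_apply, Pi.smul_apply, smul_eq_mul]
  ring

end StepControls

/-! ### Comparison of the continuous problems with their grid restrictions -/

section StrongDuality

variable {K J : Type*} [Fintype K] [Fintype J]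

/-- The increments of a control on a grid. -/
theorem Control.exists_increments {ι : Type*} {T : ℝ} (hT : 0 ≤ T) (U : Control ι T) (N : ℕ)
    {h : ℝ} (hh : 0 ≤ h) (hTN : T = N * h) :
    ∃ u : ℕ → ι → ℝ, (∀ l, 0 ≤ u l) ∧
      ∀ k ≤ N, ∃ t : Icc 0 T, (t : ℝ) = k * h ∧ ∑ l ∈ Finset.range (k + 1), u l = U t := by
  let W : ℕ → ι → ℝ := fun l => U (projIcc 0 T hT (l * h))
  have hW : Monotone W := fun i j hij => U.mono' (monotone_projIcc hT
    (mul_le_mul_of_nonneg_right (by exact_mod_cast hij) hh))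
  refine ⟨fun l => match l with | 0 => W 0 | l + 1 => W (l + 1) - W l, ?_, fun k hk => ?_⟩
  · rintro (_ | l)
    · exact U.nonneg' _
    · exact sub_nonneg.2 (hW (Nat.le_succ l))
  · have hmem : (k : ℝ) * h ∈ Icc 0 T := by
      refine ⟨by positivity, ?_⟩
      rw [hTN]
      exact mul_le_mul_of_nonneg_right (by exact_mod_cast hk) hh
    refine ⟨⟨k * h, hmem⟩, rfl, ?_⟩
    rw [← projIcc_of_mem hT hmem]
    change _ = W k
    clear hk hmem
    induction k with
    | zero => simp
    | succ k ih =>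
      rw [Finset.sum_range_succ, ih]
      exact add_sub_cancel (W k) (W (k + 1))

/-- If M-CLP and M-CLP* are feasible, then their restrictions to a grid have a pair of optimal
solutions. -/
theorem exists_gridPair {A : Matrix K J ℝ} {β b : K → ℝ} {γ c : J → ℝ} {T : ℝ} (hT : 0 ≤ T)
    {U : Control J T} (hU : PrimalFeasible A β b U) {P : Control K T} (hP : DualFeasible A γ c P)
    (N : ℕ) (hN : 1 ≤ N) :
    ∃ (u : ℕ → J → ℝ) (p : ℕ → K → ℝ), GridPair A β b γ c (T / N) N u p := by
  have hN0 : (0 : ℝ) < N := by exact_mod_cast hN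
  set h : ℝ := T / N with hh
  have hh0 : 0 ≤ h := by positivity
  have hTN : T = N * h := by rw [hh]; field_simp
  let r : ℕ → K → ℝ := fun k => β + ((k : ℝ) * h) • b
  let g : ℕ → J → ℝ := fun l => γ + (((N : ℝ) - l) * h) • c
  have hg : ∀ m ≤ N, g (N - m) = γ + ((m : ℝ) * h) • c := fun m hm => by
    simp only [g]
    rw [Nat.cast_sub hm, sub_sub_cancel]
  have hr : ∀ m ≤ N, r (N - m) = β + (((N : ℝ) - m) * h) • b := fun m hm => by
    simp only [r]
    rw [Nat.cast_sub hm]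
  obtain ⟨u, p, hu, hp, hur, hpg, hc1, hc2, hval⟩ := step_strong_duality A N r g (by
    obtain ⟨u, hu, hsum⟩ := U.exists_increments hT N hh0 hTN
    refine ⟨u, hu, fun k hk => ?_⟩
    obtain ⟨t, ht, hs⟩ := hsum k hk
    rw [hs]
    refine (hU t).trans (le_of_eq ?_)
    rw [ht]) (by
    obtain ⟨p, hp, hsum⟩ := P.exists_increments hT N hh0 hTN
    refine ⟨p, hp, fun m hm => ?_⟩
    obtain ⟨t, ht, hs⟩ := hsum m hm
    rw [hs, hg m hm, ← ht, ← Matrix.mulVec_transpose]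
    exact hP t)
  have hdual : ∀ m ≤ N, slack (-A.transpose) (-γ) (-c) h p m =
      Matrix.vecMul (∑ l ∈ Finset.range (m + 1), p l) A - g (N - m) := by
    intro m hm
    rw [hg m hm, slack, Matrix.neg_mulVec, Matrix.mulVec_transpose, smul_neg]
    abel
  refine ⟨u, p, hu, hp, fun n hn => sub_nonneg.2 (hur n hn), fun n hn => ?_, fun n hn j => ?_,
    fun n hn i => ?_, ?_⟩
  · rw [hdual n hn]
    exact sub_nonneg.2 (hpg n hn)
  · rw [hdual _ (Nat.sub_le N n), Nat.sub_sub_self hn]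
    exact hc1 n hn j
  · have := hc2 (N - n) (Nat.sub_le N n) i
    rwa [Nat.sub_sub_self hn] at this
  · refine hval.trans (Finset.sum_congr rfl fun m hm => ?_)
    rw [hr m (Nat.le_of_lt_succ (Finset.mem_range.1 hm))]

theorem primalFeasible_neg_transpose_iff {K J : Type*} [Fintype K] {A : Matrix K J ℝ}
    {γ c : J → ℝ} {T : ℝ}
    {P : Control K T} : PrimalFeasible (-A.transpose) (-γ) (-c) P ↔ DualFeasible A γ c P := by
  refine forall_congr' fun t => ?_
  rw [Matrix.neg_mulVec, smul_neg, ← neg_add, neg_le_neg_iff]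

theorem dualFeasible_neg_transpose_iff {K J : Type*} [Fintype J] {A : Matrix K J ℝ}
    {β b : K → ℝ} {T : ℝ}
    {U : Control J T} : DualFeasible (-A.transpose) (-β) (-b) U ↔ PrimalFeasible A β b U := by
  refine forall_congr' fun t => ?_
  rw [Matrix.transpose_neg, Matrix.transpose_transpose, Matrix.neg_mulVec, smul_neg, ← neg_add,
    neg_le_neg_iff]

theorem objective_neg {ι : Type*} [Fintype ι] {T : ℝ} (hT : 0 ≤ T) (g d : ι → ℝ)
    (U : Control ι T) : objective hT (-g) (-d) U = -objective hT g d U := by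
  rw [objective_eq, objective_eq, ← Finset.sum_neg_distrib]
  refine Finset.sum_congr rfl fun i _ => ?_
  simp only [Pi.neg_apply]
  ring

/-- If M-CLP and M-CLP* are feasible, then M-CLP has a feasible solution whose objective is at
least the values of the optimal solutions on grids, up to an error of the order of the mesh. -/
theorem exists_objective_ge {A : Matrix K J ℝ} {β b : K → ℝ} {γ c : J → ℝ} {T : ℝ} (hT : 0 ≤ T)
    {U : Control J T} (hU : PrimalFeasible A β b U) {P : Control K T}
    (hP : DualFeasible A γ c P) :
    ∃ (V : Control J T) (C : ℝ), PrimalFeasible A β b V ∧ ∀ (N : ℕ), 1 ≤ N →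
      ∀ (u : ℕ → J → ℝ) (p : ℕ → K → ℝ), GridPair A β b γ c (T / N) N u p →
        ∑ n ∈ Finset.range (N + 1), (γ + (((N : ℝ) - n) * (T / N)) • c) ⬝ᵥ u n - C / N ≤
          objective hT γ c V := by
  obtain ⟨C, hC⟩ := exists_stepValue_ge A β b γ c hT hP
  -- The one-step grid serves only to show that the compact set is nonempty.
  obtain ⟨u₁, p₁, H₁⟩ := exists_gridPair hT hU hP 1 le_rfl
  obtain ⟨q₁, hq₁, -⟩ := hC 1 le_rfl u₁ p₁ H₁
  obtain ⟨q, hq, hmax⟩ := exists_isMaxOn_stepValue A β b γ c T _ C ⟨q₁, hq₁⟩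
  refine ⟨stepControl _ q.1 hq.1 q.2 hq.2.2.2.2.1, C, primalFeasible_stepControl hq,
    fun N hN u p H => ?_⟩
  obtain ⟨q', hq', hle⟩ := hC N hN u p H
  rw [objective_stepControl hT γ c hq]
  exact hle.trans (hmax q' hq')

end StrongDuality

end MCLP

theorem mainTheorem2 {K J : Type*} [Fintype K] [Fintype J]
    (A : Matrix K J ℝ) (β b : K → ℝ) (γ c : J → ℝ) (T : ℝ) (hT : 0 ≤ T)
    (hprimal : ∃ U : MCLP.Control J T, MCLP.PrimalFeasible A β b U)
    (hdual : ∃ P : MCLP.Control K T, MCLP.DualFeasible A γ c P) :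
    ∃ (U : MCLP.Control J T) (P : MCLP.Control K T),
      MCLP.PrimalOptimal hT A β b γ c U ∧ MCLP.DualOptimal hT A β b γ c P ∧
        MCLP.objective hT γ c U = MCLP.objective hT β b P := by
  obtain ⟨U₀, hU₀⟩ := hprimal
  obtain ⟨P₀, hP₀⟩ := hdual
  obtain ⟨U, C, hU, hUC⟩ := MCLP.exists_objective_ge hT hU₀ hP₀
  obtain ⟨P, D, hP, hPD⟩ := MCLP.exists_objective_ge hT
    (MCLP.primalFeasible_neg_transpose_iff.2 hP₀) (MCLP.dualFeasible_neg_transpose_iff.2 hU₀)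
  rw [MCLP.primalFeasible_neg_transpose_iff] at hP
  rw [MCLP.objective_neg] at hPD
  have hle : MCLP.objective hT β b P ≤ MCLP.objective hT γ c U := by
    by_contra! hlt
    -- The common grid value is at most the objective of U plus C / N and at least that of P minus D
    -- / N; this N makes the total error smaller than the supposed gap.
    obtain ⟨N, hN⟩ := exists_nat_gt
      (max 0 ((C + D) / (MCLP.objective hT β b P - MCLP.objective hT γ c U)))
    have hN0 : (0 : ℝ) < N := (le_max_left _ _).trans_lt hN
    have hN1 : 1 ≤ N := by exact_mod_cast hN0
    obtain ⟨u, p, H⟩ := MCLP.exists_gridPair hT hU₀ hP₀ N hN1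
    have h1 := hUC N hN1 u p H
    have h2 := hPD N hN1 p u H.swap
    have h3 := (le_max_right _ _).trans_lt hN
    rw [div_lt_iff₀ (sub_pos.2 hlt)] at h3
    simp only [smul_neg, ← neg_add, neg_dotProduct, Finset.sum_neg_distrib, ← H.value_eq] at h2
    have h4 : (C + D) / N < MCLP.objective hT β b P - MCLP.objective hT γ c U := by
      rw [div_lt_iff₀ hN0]
      linarith
    rw [add_div] at h4
    linarith
  have heq := le_antisymm (MCLP.objective_le_objective hT hU hP) hle
  exact ⟨U, P, ⟨hU, fun V hV => (MCLP.objective_le_objective hT hV hP).trans hle⟩,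
    ⟨hP, fun Q hQ => hle.trans (MCLP.objective_le_objective hT hU hQ)⟩, heq⟩
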